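/- **Theorem 2.1 (Convergence for equidistributing meshes).** Let $\Omega=(0,1)$, let $a,b\in W^{1,\infty}(\Omega)$ and $c\in L^\infty(\Omega)$ satisfy $a\ge a_0>0$ and $c-\tfrac12 b'\ge 0$ a.e. in $\Omega$, for a constant $a_0$, and let $f\in L^2(\Omega)$. Put $B(u,v)=\int_\Omega (a u'v'+b u'v+cuv)\,dx$ and $(f,v)=\int_\Omega fv\,dx$, and let $u\in H^1_0(\Omega)$ be the weak solution of $-(au')'+bu'+cu=f$, $u(0)=u(1)=0$, that is, $B(u,v)=(f,v)$ for all $v\in H_0^1(\Omega)$. Let $r=f+a'u'-bu'-cu$. For a mesh $0=x_0<x_1<\dots<x_N=1$ with $h_i=x_i-x_{i-1}$, let $V_h$ be the span of the continuous piecewise linear (hat) basis functions of the interior nodes $x_1,\dots,x_{N-1}$, let $u_h\in V_h$ be the linear finite element solution, $B(u_h,v_h)=(f,v_h)$ for all $v_h\in V_h$, and put $$r_h=f+a'u_h'-bu_h'-cu_h,\qquad \langle r_h\rangle_i=\Big(\frac1{h_i}\int_{x_{i-1}}^{x_i}|r_h|^2dx\Big)^{1/2},$$ $$\alpha_h=\Big[\sum_{i=1}^N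 h_i\langle r_h\rangle_i^{2/3}\Big]^3,\qquad \rho_i=\Big(1+\frac{\langle r_h\rangle_i^2}{\alpha_h}\Big)^{1/3},\qquad \sigma_h=\sum_{i=1}^N\rho_ih_i$$ (with $\rho_i=1$ if $\alpha_h=0$). The mesh is called equidistributing if $\rho_ih_i=\sigma_h/N$ for $i=1,\dots,N$. Write $\|v\|_{L^p(\Omega)}=\big(\int_\Omega|v|^p\,dx\big)^{1/p}$ for all $p>0$. There are positive constants $C$ and $c_0$, depending only on the coefficients $a,b,c$ (not on $f$, $u$, $N$ or the mesh), such that the following hold. 1. For every $N$ and every equidistributing mesh with $N$ cells, $$\|(u-u_h)'\|_{L^2(\Omega)}\le \frac{C\sqrt{\alpha_h}}{N}.$$ 2. $\sqrt{\alpha_h}\to\|r\|_{L^{2/3}(\Omega)}$ as $N\to\infty$ along equidistributing meshes: for every $\varepsilon>0$ there is $N_0$ such that $\big|\sqrt{\alpha_h}-\|r\|_{L^{2/3}(\Omega)}\big|<\varepsilon$ for every equidistributing mesh with $N\ge N_0$ cells. 3. If in addition $r$ has a weak derivative $r'\in L^1(\Omega)$, then for every $N>c_0$ and every equidistributing mesh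 with $N$ cells, $$\Big(1+\big(\tfrac{c_0}{N}\big)^{2/3}\Big)^{-3/2}\|r\|_{L^{2/3}(\Omega)}\le\sqrt{\alpha_h}\le\Big(1-\big(\tfrac{c_0}{N}\big)^{2/3}\Big)^{-3/2}\Big[\|r\|_{L^{2/3}(\Omega)}^{2/3}+\Big(\frac{c_0\|r'\|_{L^1(\Omega)}}{N}\Big)^{2/3}\Big]^{3/2}.$$ -/

import Mathlib

open MeasureTheory Filter Topology
open scoped ContDiff

noncomputable section

namespace EquiFEM

/-- The domain `Ω = (0,1)`. -/
def Omega : Set ℝ := Set.Ioo 0 1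

/-- Lebesgue measure on `Ω`. -/
def muOmega : Measure ℝ := volume.restrict Omega

/-- Test functions on `Ω`: smooth, with compact support inside `Ω`. -/
structure IsTest (φ : ℝ → ℝ) : Prop where
  smooth : ContDiff ℝ ∞ φ
  compact : HasCompactSupport φ
  support : tsupport φ ⊆ Omega

/-- `g'` is a weak (distributional) derivative of `g` on `Ω`. -/
structure HasWeakDeriv (g g' : ℝ → ℝ) : Prop where
  locInt : LocallyIntegrableOn g Omega
  locInt_deriv : LocallyIntegrableOn g' Omega
  parts : ∀ φ : ℝ → ℝ, IsTest φ →
    ∫ x in Omega, g x * deriv φ x = - ∫ x in Omega, g' x * φ x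

/-- `g ∈ W^{1,∞}(Ω)`, with weak derivative `g'`. -/
structure MemW1Inf (g g' : ℝ → ℝ) : Prop where
  weak : HasWeakDeriv g g'
  memLp : MemLp g ⊤ muOmega
  memLp_deriv : MemLp g' ⊤ muOmega

/-- `v ∈ H¹(Ω)`, with weak derivative `v'`. -/
structure MemH1 (v v' : ℝ → ℝ) : Prop where
  weak : HasWeakDeriv v v'
  memLp : MemLp v 2 muOmega
  memLp_deriv : MemLp v' 2 muOmega

/-- `v ∈ H¹₀(Ω)`, with weak derivative `v'`: `v` lies in the closure in `H¹(Ω)` of the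
test functions. -/
structure MemH10 (v v' : ℝ → ℝ) : Prop where
  memH1 : MemH1 v v'
  approx : ∃ φ : ℕ → ℝ → ℝ, (∀ n, IsTest (φ n)) ∧
    Tendsto (fun n => eLpNorm (fun x => φ n x - v x) 2 muOmega) atTop (𝓝 0) ∧
    Tendsto (fun n => eLpNorm (fun x => deriv (φ n) x - v' x) 2 muOmega) atTop (𝓝 0)

/-- `‖v‖_{L^p(Ω)} = (∫_Ω |v|^p)^{1/p}` for real `p > 0` (including `p < 1`). -/
def normLp (p : ℝ) (v : ℝ → ℝ) : ℝ := (∫ x in Omega, |v x| ^ p) ^ (1 / p)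

/-- Standing assumptions on the coefficients of `-(a u')' + b u' + c u = f`;
`a'` and `b'` are weak derivatives of `a` and `b`. -/
structure IsElliptic (a a' b b' c : ℝ → ℝ) (a₀ : ℝ) : Prop where
  memA : MemW1Inf a a'
  memB : MemW1Inf b b'
  memC : MemLp c ⊤ muOmega
  pos : 0 < a₀
  lower : ∀ᵐ x ∂muOmega, a₀ ≤ a x
  nonneg : ∀ᵐ x ∂muOmega, 0 ≤ c x - b' x / 2

/-- `B(u,v) = ∫_Ω (a u' v' + b u' v + c u v)`; `u'` and `v'` are passed explicitly. -/
def bform (a b c u u' v v' : ℝ → ℝ) : ℝ :=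
  ∫ x in Omega, (a x * u' x * v' x + b x * u' x * v x + c x * u x * v x)

/-- `(f,v) = ∫_Ω f v`. -/
def load (f v : ℝ → ℝ) : ℝ := ∫ x in Omega, f x * v x

/-- `u ∈ H¹₀(Ω)`, with weak derivative `u'`, solves the variational problem. -/
structure IsWeakSol (a b c f u u' : ℝ → ℝ) : Prop where
  mem : MemH10 u u'
  eqn : ∀ v v' : ℝ → ℝ, MemH10 v v' → bform a b c u u' v v' = load f v

/-- A mesh `0 = x_0 < x_1 < ⋯ < x_N = 1` (values of `x` at indices above `N` play no role). -/
structure Mesh (N : ℕ) where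
  x : ℕ → ℝ
  x_zero : x 0 = 0
  x_last : x N = 1
  x_lt : ∀ i < N, x i < x (i + 1)

namespace Mesh

variable {N : ℕ} (m : Mesh N)

/-- Length of the cell `(x_i, x_{i+1})`; the `N` cells are numbered `0, …, N - 1`. -/
def h (i : ℕ) : ℝ := m.x (i + 1) - m.x i

/-- The piecewise linear basis function of the interior node `x_{i+1}`, `i + 1 < N`: it is `1` at
`x_{i+1}`, `0` outside `(x_i, x_{i+2})`, and linear on the two cells between. -/
def hat (i : ℕ) (t : ℝ) : ℝ :=
  max 0 (min ((t - m.x i) / m.h i) ((m.x (i + 2) - t) / m.h (i + 1)))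

/-- The linear finite element space spanned by the basis functions of the `N - 1`
interior nodes. -/
def feSpace : Submodule ℝ (ℝ → ℝ) :=
  Submodule.span ℝ {φ | ∃ i : ℕ, i + 1 < N ∧ φ = m.hat i}

/-- `u_h` is the linear finite element solution on the mesh. Elements of the space are
differentiable off the mesh points, so `deriv` is their weak derivative. -/
structure IsFESol (a b c f uh : ℝ → ℝ) : Prop where
  mem : uh ∈ m.feSpace
  eqn : ∀ v ∈ m.feSpace, bform a b c uh (deriv uh) v (deriv v) = load f v

/-- `⟨w⟩_i`, the `L²` average of `w` over the `i`-th cell. -/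
def avg (w : ℝ → ℝ) (i : ℕ) : ℝ :=
  Real.sqrt (1 / m.h i * ∫ x in Set.Ioo (m.x i) (m.x (i + 1)), |w x| ^ 2)

/-- `α_h = [Σ_i h_i ⟨w⟩_i^{2/3}]³`, for the residual `w`. -/
def alpha (w : ℝ → ℝ) : ℝ :=
  (∑ i ∈ Finset.range N, m.h i * m.avg w i ^ (2 / 3 : ℝ)) ^ 3

/-- `ρ_i = (1 + ⟨w⟩_i² / α_h)^{1/3}`, for the residual `w`
(equal to `1` in the degenerate case `α_h = 0`, in which all the `⟨w⟩_i` vanish). -/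
def rho (w : ℝ → ℝ) (i : ℕ) : ℝ :=
  (1 + m.avg w i ^ 2 / m.alpha w) ^ (1 / 3 : ℝ)

/-- `σ_h = Σ_i ρ_i h_i`. -/
def sigma (w : ℝ → ℝ) : ℝ := ∑ i ∈ Finset.range N, m.rho w i * m.h i

/-- The equidistribution principle `ρ_i h_i = σ_h / N` on all cells. -/
def Equidistributes (w : ℝ → ℝ) : Prop :=
  ∀ i < N, m.rho w i * m.h i = m.sigma w / N

end Mesh

/-- The residual `f + a' v' - b v' - c v`. -/
def residual (a' b c f v v' : ℝ → ℝ) (x : ℝ) : ℝ :=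
  f x + a' x * v' x - b x * v' x - c x * v x

/-- `uh` is the finite element solution on the mesh `m`, and `m` equidistributes the adaptation
function that is computed from the residual of this very `uh`. -/
structure IsEquiFESol {N : ℕ} (m : Mesh N) (a a' b c f uh : ℝ → ℝ) : Prop where
  sol : m.IsFESol a b c f uh
  equi : m.Equidistributes (residual a' b c f uh (deriv uh))

end EquiFEM

end

/-! Write `S(w) = Σ h_i ⟨w⟩_i^(2/3)` (`avgSum`), so that `√α_h = S(r_h)^(3/2)`. The theorem combines
an a posteriori error bound with a stability estimate for `S`.

Energy bound: let `E = u - u_h` and let `W` be `E` minus its nodal interpolant. Coercivity, Galerkin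
orthogonality and integration by parts on the cells, where `u_h'` is constant, give `a₀ ‖E'‖² ≤ B(E,
W) = (r_h, W)`. On each cell `|W| ≤ 2 ∫ |E'|`, hence `a₀ ‖E'‖ ≤ 2 (Σ h_i³ ⟨r_h⟩_i²)^(1/2)`
(`error_estimate`). By the definition of `ρ`, `⟨r_h⟩_i² ≤ α_h ρ_i³`, and the normalization by `α_h`
forces `σ_h ≤ 2`. Equidistribution then gives `ρ_i h_i ≤ 2/N`, and the sum is at most `8 α_h / N²`.

Residuals: `r - r_h = (a' - b) E' - c E` has `L²` norm at most a constant times `‖E'‖`, thus at most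
`K √α_h / N`. Since `S` is subadditive and `∫ |w|^(2/3) ≤ S(w) ≤ ‖w‖_{L²}^(2/3)`, the numbers `S(r)`
and `S(r_h)` differ by at most `(K/N)^(2/3) S(r_h)`. This error is relative to the unknown `S(r_h)`
itself and can be absorbed without any a priori bound on it.

It remains to compare `S(r)` with `∫ |r|^(2/3)`. One inequality is Jensen. As `ρ_i ≥ 1`, all cells
have length at most `2/N`; the converse therefore holds up to a vanishing error by density of
continuous functions, and up to `(2 ‖r'‖_{L¹} / N)^(2/3)` when `r'` is integrable. -/

namespace EquiFEM

/-! ### Absolutely continuous functions on the unit interval -/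

/-- `F` is absolutely continuous on `[0,1]` with derivative `f`. -/
structure IsPrimitive (F f : ℝ → ℝ) : Prop where
  integrable : IntervalIntegrable f volume 0 1
  eq : ∀ x ∈ Set.Icc (0 : ℝ) 1, F x = F 0 + ∫ t in (0 : ℝ)..x, f t

lemma muOmega_eq_restrict_Ioc : muOmega = volume.restrict (Set.Ioc (0 : ℝ) 1) :=
  Measure.restrict_congr_set Ioo_ae_eq_Ioc

lemma integral_Omega (g : ℝ → ℝ) : ∫ x in Omega, g x = ∫ x in (0 : ℝ)..1, g x := by
  rw [intervalIntegral.integral_of_le zero_le_one, ← integral_Ioc_eq_integral_Ioo.symm]; rfl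

lemma integrable_iff_intervalIntegrable {g : ℝ → ℝ} :
    Integrable g muOmega ↔ IntervalIntegrable g volume 0 1 := by
  rw [intervalIntegrable_iff_integrableOn_Ioc_of_le zero_le_one, IntegrableOn,
    muOmega_eq_restrict_Ioc]

instance : IsProbabilityMeasure muOmega := ⟨by simp [muOmega, Omega]⟩

lemma intervalIntegrable_sub {f : ℝ → ℝ} (hf : IntervalIntegrable f volume 0 1) {s t : ℝ}
    (hs : s ∈ Set.Icc (0 : ℝ) 1) (ht : t ∈ Set.Icc (0 : ℝ) 1) :
    IntervalIntegrable f volume s t := by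
  apply hf.mono_set
  rw [Set.uIcc_of_le (zero_le_one (α := ℝ))]
  exact Set.uIcc_subset_Icc hs ht

namespace IsPrimitive

variable {F f G g : ℝ → ℝ}

lemma sub_eq (h : IsPrimitive F f) {s t : ℝ} (hs : s ∈ Set.Icc (0 : ℝ) 1)
    (ht : t ∈ Set.Icc (0 : ℝ) 1) : F t - F s = ∫ x in s..t, f x := by
  have h0 : (0 : ℝ) ∈ Set.Icc (0 : ℝ) 1 := by simp
  rw [h.eq t ht, h.eq s hs, ← intervalIntegral.integral_interval_sub_left
    (intervalIntegrable_sub h.integrable h0 ht) (intervalIntegrable_sub h.integrable h0 hs)]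
  ring

/-- The formula stands in for `F`, whose values off `[0,1]` are unconstrained. -/
lemma absolutelyContinuous (h : IsPrimitive F f) :
    AbsolutelyContinuousOnInterval (fun x => F 0 + ∫ t in (0 : ℝ)..x, f t) 0 1 := by
  have h1 : AbsolutelyContinuousOnInterval (fun _ : ℝ => F 0) 0 1 :=
    (contDiff_const (n := 1)).contDiffOn.absolutelyContinuousOnInterval
  exact h1.fun_add (h.integrable.absolutelyContinuousOnInterval_intervalIntegral (by simp))

lemma continuousOn (h : IsPrimitive F f) : ContinuousOn F (Set.Icc 0 1) := by
  have := h.absolutelyContinuous.continuousOn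
  rw [Set.uIcc_of_le zero_le_one] at this
  exact this.congr fun x hx => h.eq x hx

lemma ae_hasDerivAt (h : IsPrimitive F f) :
    ∀ᵐ x, x ∈ Set.Icc (0 : ℝ) 1 →
      HasDerivAt (fun x => F 0 + ∫ t in (0 : ℝ)..x, f t) (f x) x := by
  filter_upwards [h.integrable.ae_hasDerivAt_integral] with x hx hx1
  rw [Set.uIcc_of_le zero_le_one] at hx
  simpa using (hx hx1 0 (by simp)).const_add (F 0)

/-- The product rule for absolutely continuous functions; every integration by parts below is an
instance of it. -/
lemma mul (hF : IsPrimitive F f) (hG : IsPrimitive G g) :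
    IsPrimitive (fun x => F x * G x) (fun x => f x * G x + F x * g x) := by
  have hu : Set.uIcc (0 : ℝ) 1 = Set.Icc 0 1 := Set.uIcc_of_le zero_le_one
  have hGc := hG.continuousOn
  have hFc := hF.continuousOn
  rw [← hu] at hGc hFc
  refine ⟨(hF.integrable.mul_continuousOn hGc).add (hG.integrable.continuousOn_mul hFc), ?_⟩
  intro x hx
  have hsub : Set.uIcc 0 x ⊆ Set.uIcc (0 : ℝ) 1 := by
    rw [hu]; exact Set.uIcc_subset_Icc (by simp) hx
  have key := (hF.absolutelyContinuous.mono hsub).integral_deriv_mul_eq_sub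
    (hG.absolutelyContinuous.mono hsub)
  have h2 : ∫ t in (0 : ℝ)..x, f t * G t + F t * g t =
      ∫ t in (0 : ℝ)..x, deriv (fun x => F 0 + ∫ t in (0 : ℝ)..x, f t) t *
        (G 0 + ∫ t in (0 : ℝ)..t, g t) + (F 0 + ∫ t in (0 : ℝ)..t, f t) *
        deriv (fun x => G 0 + ∫ t in (0 : ℝ)..x, g t) t := by
    apply intervalIntegral.integral_congr_ae
    filter_upwards [hF.ae_hasDerivAt, hG.ae_hasDerivAt] with t h1 h2 ht
    have ht' : t ∈ Set.Icc (0 : ℝ) 1 := by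
      rw [← hu]; exact hsub (Set.uIoc_subset_uIcc ht)
    rw [(h1 ht').deriv, (h2 ht').deriv, ← hF.eq t ht', ← hG.eq t ht']
  rw [h2, key, ← hF.eq x hx, ← hG.eq x hx]
  simp

lemma integral_mul_add (hF : IsPrimitive F f) (hG : IsPrimitive G g) {s t : ℝ}
    (hs : s ∈ Set.Icc (0 : ℝ) 1) (ht : t ∈ Set.Icc (0 : ℝ) 1) :
    ∫ x in s..t, (f x * G x + F x * g x) = F t * G t - F s * G s :=
  ((hF.mul hG).sub_eq hs ht).symm

lemma integral_mul (hF : IsPrimitive F f) (hG : IsPrimitive G g) {s t : ℝ}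
    (hs : s ∈ Set.Icc (0 : ℝ) 1) (ht : t ∈ Set.Icc (0 : ℝ) 1) :
    ∫ x in s..t, F x * g x = F t * G t - F s * G s - ∫ x in s..t, f x * G x := by
  have hu : Set.uIcc (0 : ℝ) 1 = Set.Icc 0 1 := Set.uIcc_of_le zero_le_one
  have hGc := hG.continuousOn
  have hFc := hF.continuousOn
  rw [← hu] at hGc hFc
  rw [← hF.integral_mul_add hG hs ht, intervalIntegral.integral_add
    (intervalIntegrable_sub (hF.integrable.mul_continuousOn hGc) hs ht)
    (intervalIntegrable_sub (hG.integrable.continuousOn_mul hFc) hs ht)]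
  ring

lemma sub (hF : IsPrimitive F f) (hG : IsPrimitive G g) :
    IsPrimitive (fun x => F x - G x) (fun x => f x - g x) := by
  refine ⟨hF.integrable.sub hG.integrable, fun x hx => ?_⟩
  have h0 : (0 : ℝ) ∈ Set.Icc (0 : ℝ) 1 := by simp
  rw [intervalIntegral.integral_sub (intervalIntegrable_sub hF.integrable h0 hx)
    (intervalIntegrable_sub hG.integrable h0 hx), hF.eq x hx, hG.eq x hx]
  ring

lemma of_integrable (hf : Integrable f muOmega) (k : ℝ) :
    IsPrimitive (fun x => k + ∫ t in (0 : ℝ)..x, f t) f :=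
  ⟨integrable_iff_intervalIntegrable.1 hf, fun x _ => by simp⟩

lemma of_contDiff (hF : ContDiff ℝ 1 F) : IsPrimitive F (deriv F) := by
  have hc : Continuous (deriv F) := hF.continuous_deriv le_rfl
  refine ⟨hc.intervalIntegrable _ _, fun x _ => ?_⟩
  rw [intervalIntegral.integral_deriv_eq_sub' _ rfl
    (fun x _ => (hF.differentiable one_ne_zero) x) hc.continuousOn]
  ring

end IsPrimitive

/-! ### Test functions and weak derivatives -/

lemma ae_muOmega_mem : ∀ᵐ x ∂muOmega, x ∈ Set.Icc (0 : ℝ) 1 := by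
  filter_upwards [ae_restrict_mem (μ := volume) (measurableSet_Ioo (a := (0 : ℝ)) (b := 1))]
    with x hx using Set.Ioo_subset_Icc_self hx

lemma IsTest.exists_Icc {φ : ℝ → ℝ} (h : IsTest φ) :
    ∃ α β : ℝ, 0 < α ∧ α ≤ β ∧ β < 1 ∧ tsupport φ ⊆ Set.Icc α β := by
  rcases (tsupport φ).eq_empty_or_nonempty with he | hne
  · exact ⟨1 / 2, 1 / 2, by norm_num, le_rfl, by norm_num, by simp [he]⟩
  · obtain ⟨α, hα, hα'⟩ := h.compact.isCompact.exists_isLeast hne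
    obtain ⟨β, hβ, hβ'⟩ := h.compact.isCompact.exists_isGreatest hne
    exact ⟨α, β, (h.support hα).1, hα' hβ, (h.support hβ).2, fun x hx => ⟨hα' hx, hβ' hx⟩⟩

lemma IsTest.deriv {φ : ℝ → ℝ} (h : IsTest φ) : IsTest (deriv φ) :=
  ⟨(contDiff_infty_iff_deriv.1 h.smooth).2, h.compact.deriv,
    (tsupport_deriv_subset).trans h.support⟩

lemma IsTest.sub {φ ψ : ℝ → ℝ} (h : IsTest φ) (k : IsTest ψ) :
    IsTest (fun x => φ x - ψ x) := by
  have hs : tsupport (fun x => φ x - ψ x) ⊆ tsupport φ ∪ tsupport ψ := by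
    apply closure_minimal _ ((isClosed_tsupport _).union (isClosed_tsupport _))
    intro x hx
    by_contra hc
    rw [Set.mem_union, not_or] at hc
    exact hx (by simp [image_eq_zero_of_notMem_tsupport hc.1,
      image_eq_zero_of_notMem_tsupport hc.2])
  refine ⟨h.smooth.sub k.smooth, ?_, hs.trans (Set.union_subset h.support k.support)⟩
  exact (h.compact.isCompact.union k.compact.isCompact).of_isClosed_subset
    (isClosed_tsupport _) hs

lemma IsTest.const_mul {φ : ℝ → ℝ} (h : IsTest φ) (k : ℝ) : IsTest (fun x => k * φ x) := by
  have hs : tsupport (fun x => k * φ x) ⊆ tsupport φ := tsupport_mul_subset_right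
  exact ⟨contDiff_const.mul h.smooth, h.compact.isCompact.of_isClosed_subset
    (isClosed_tsupport _) hs, hs.trans h.support⟩

lemma IsTest.add {φ ψ : ℝ → ℝ} (h : IsTest φ) (k : IsTest ψ) :
    IsTest (fun x => φ x + ψ x) := by
  have := h.sub (k.const_mul (-1))
  simpa using this

lemma IsTest.eq_zero {φ : ℝ → ℝ} (h : IsTest φ) {x : ℝ} (hx : x ∉ Omega) : φ x = 0 :=
  image_eq_zero_of_notMem_tsupport fun hc => hx (h.support hc)

lemma IsTest.isPrimitive {φ : ℝ → ℝ} (h : IsTest φ) : IsPrimitive φ (_root_.deriv φ) :=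
  .of_contDiff (h.smooth.of_le (by exact_mod_cast le_top))

lemma IsTest.integrable_mul {g φ : ℝ → ℝ} (hg : LocallyIntegrableOn g Omega) (h : IsTest φ) :
    Integrable (fun x => g x * φ x) muOmega := by
  have h1 : IntegrableOn g (tsupport φ) :=
    hg.integrableOn_compact_subset h.support h.compact.isCompact
  have h2 : IntegrableOn (fun x => g x * φ x) (tsupport φ) :=
    h1.mul_continuousOn h.smooth.continuous.continuousOn h.compact.isCompact
  rw [integrableOn_iff_integrable_of_support_subset] at h2
  · exact h2.integrableOn
  · intro x hx
    by_contra hc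
    exact hx (by simp [image_eq_zero_of_notMem_tsupport hc])

/-- The primitive starting at 0 vanishes to the left of the support of `θ`, and to the right of it
because the total integral is zero. -/
lemma exists_isTest_deriv_eq {θ : ℝ → ℝ} (h : IsTest θ) (h0 : ∫ x in Omega, θ x = 0) :
    ∃ φ, IsTest φ ∧ deriv φ = θ := by
  obtain ⟨α, β, hα, hαβ, hβ, hs⟩ := h.exists_Icc
  have hc : Continuous θ := h.smooth.continuous
  have hd : ∀ x, HasDerivAt (fun x => ∫ t in (0 : ℝ)..x, θ t) (θ x) x := fun x =>
    intervalIntegral.integral_hasDerivAt_right (hc.intervalIntegrable _ _)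
      hc.stronglyMeasurable.stronglyMeasurableAtFilter hc.continuousAt
  have hd' : deriv (fun x => ∫ t in (0 : ℝ)..x, θ t) = θ := funext fun x => (hd x).deriv
  have hz : ∀ x, x ∉ Set.Icc α β → θ x = 0 := fun x hx =>
    image_eq_zero_of_notMem_tsupport fun hm => hx (hs hm)
  have hsupp : tsupport (fun x => ∫ t in (0 : ℝ)..x, θ t) ⊆ Set.Icc α β := by
    apply closure_minimal _ isClosed_Icc
    intro x hx
    by_contra hn
    apply hx
    rw [Set.mem_Icc, not_and_or, not_le, not_le] at hn
    rcases hn with hn | hn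
    · apply intervalIntegral.integral_zero_ae
      refine Eventually.of_forall fun t ht => hz t fun hm => ?_
      have := ht.2
      rcases le_max_iff.1 this with h | h <;> linarith [hm.1]
    · have h1 : ∫ t in (1 : ℝ)..x, θ t = 0 := by
        apply intervalIntegral.integral_zero_ae
        refine Eventually.of_forall fun t ht => hz t fun hm => ?_
        have := ht.1
        rcases min_lt_iff.1 this with h | h <;> linarith [hm.2]
      rw [integral_Omega] at h0
      show ∫ t in (0 : ℝ)..x, θ t = 0
      rw [← intervalIntegral.integral_add_adjacent_intervals
        (hc.intervalIntegrable 0 1) (hc.intervalIntegrable 1 x), h0, h1, add_zero]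
  refine ⟨fun x => ∫ t in (0 : ℝ)..x, θ t, ⟨?_, ?_, ?_⟩, hd'⟩
  · rw [contDiff_infty_iff_deriv, hd']
    exact ⟨fun x => (hd x).differentiableAt, h.smooth⟩
  · exact isCompact_Icc.of_isClosed_subset (isClosed_tsupport _) hsupp
  · exact hsupp.trans fun x hx => ⟨hα.trans_le hx.1, hx.2.trans_lt hβ⟩

lemma exists_isTest_integral_eq_one : ∃ ψ, IsTest ψ ∧ ∫ x in Omega, ψ x = 1 := by
  let B : ContDiffBump (1 / 2 : ℝ) := ⟨1 / 8, 1 / 4, by norm_num, by norm_num⟩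
  have hsupp : tsupport (B.normed volume) ⊆ Omega := by
    rw [B.tsupport_normed_eq, Real.closedBall_eq_Icc]
    intro x hx
    have hr : B.rOut = 1 / 4 := rfl
    rw [hr] at hx
    exact ⟨by linarith [hx.1], by linarith [hx.2]⟩
  refine ⟨B.normed volume, ⟨B.contDiff_normed, B.hasCompactSupport_normed, hsupp⟩, ?_⟩
  rw [setIntegral_eq_integral_of_forall_compl_eq_zero, B.integral_normed]
  exact fun x hx => image_eq_zero_of_notMem_tsupport fun hm => hx (hsupp hm)

/-- **Du Bois-Reymond lemma**. -/
lemma ae_eq_const_of_integral_mul_deriv {g : ℝ → ℝ} (hg : LocallyIntegrableOn g Omega)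
    (h : ∀ φ, IsTest φ → ∫ x in Omega, g x * deriv φ x = 0) :
    ∃ k : ℝ, ∀ᵐ x ∂muOmega, g x = k := by
  obtain ⟨ψ, hψ, hψ1⟩ := exists_isTest_integral_eq_one
  set k := ∫ x in Omega, g x * ψ x with hk
  have hli : LocallyIntegrableOn (fun x => g x - k) Omega :=
    hg.sub (locallyIntegrableOn_const k)
  have h1 : LocallyIntegrableOn (fun _ : ℝ => (1 : ℝ)) Omega := locallyIntegrableOn_const 1
  refine ⟨k, ?_⟩
  have key := IsOpen.ae_eq_zero_of_integral_contDiff_smul_eq_zero (μ := volume)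
    (U := Omega) isOpen_Ioo hli ?_
  · have h2 : ∀ᵐ x ∂muOmega, x ∈ Omega := ae_restrict_mem measurableSet_Ioo
    filter_upwards [ae_restrict_of_ae key, h2] with x hx hx2
    linarith [hx hx2]
  · intro φ hφ1 hφ2 hφ3
    have hφ : IsTest φ := ⟨hφ1, hφ2, hφ3⟩
    have hiφ : Integrable φ muOmega := by simpa using hφ.integrable_mul h1
    have hiψ : Integrable ψ muOmega := by simpa using hψ.integrable_mul h1
    rw [← setIntegral_eq_integral_of_forall_compl_eq_zero (s := Omega)
      (fun x hx => by simp [hφ.eq_zero hx])]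
    set m := ∫ x in Omega, φ x with hm
    -- Removing the mean by a multiple of `ψ` leaves the derivative of a test function, which `g`
    -- annihilates.
    have hθ := hφ.sub (hψ.const_mul m)
    have hθ0 : ∫ x in Omega, (φ x - m * ψ x) = 0 := by
      have : ∫ x, (φ x - m * ψ x) ∂muOmega = 0 := by
        rw [integral_sub hiφ (hiψ.const_mul m), integral_const_mul]
        have e1 : ∫ x, φ x ∂muOmega = m := rfl
        have e2 : ∫ x, ψ x ∂muOmega = 1 := hψ1
        rw [e1, e2]; ring
      exact this
    obtain ⟨Φ, hΦ, hΦ'⟩ := exists_isTest_deriv_eq hθ hθ0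
    have h3 := h Φ hΦ
    rw [hΦ'] at h3
    have i1 := hφ.integrable_mul hg
    have i2 := hψ.integrable_mul hg
    have e3 : ∫ x, g x * (φ x - m * ψ x) ∂muOmega = ∫ x, g x * φ x ∂muOmega - m * k := by
      have : ∀ x, g x * (φ x - m * ψ x) = g x * φ x - m * (g x * ψ x) := fun x => by ring
      simp_rw [this]
      rw [integral_sub i1 (i2.const_mul m), integral_const_mul]
      rfl
    have e4 : ∫ x, φ x • (g x - k) ∂muOmega = ∫ x, g x * φ x ∂muOmega - k * m := by
      have : ∀ x, φ x • (g x - k) = g x * φ x - k * φ x := fun x => by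
        rw [smul_eq_mul]; ring
      simp_rw [this]
      rw [integral_sub i1 (hiφ.const_mul k), integral_const_mul]
      rfl
    have e5 : ∫ x, g x * (φ x - m * ψ x) ∂muOmega = 0 := h3
    show ∫ x, φ x • (g x - k) ∂muOmega = 0
    rw [e4]; linarith

lemma IsPrimitive.integral_mul_deriv_test {G g φ : ℝ → ℝ} (hG : IsPrimitive G g)
    (hφ : IsTest φ) : ∫ x in Omega, G x * deriv φ x = - ∫ x in Omega, g x * φ x := by
  rw [integral_Omega, integral_Omega, hG.integral_mul hφ.isPrimitive (by simp) (by simp),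
    hφ.eq_zero (x := 0) (by simp [Omega]), hφ.eq_zero (x := 1) (by simp [Omega])]
  ring

lemma IsPrimitive.locallyIntegrableOn {G g : ℝ → ℝ} (hG : IsPrimitive G g) :
    LocallyIntegrableOn G Omega :=
  ((hG.continuousOn.integrableOn_Icc).mono_set Set.Ioo_subset_Icc_self).locallyIntegrableOn

lemma locallyIntegrableOn_of_integrable {g : ℝ → ℝ} (h : Integrable g muOmega) :
    LocallyIntegrableOn g Omega :=
  IntegrableOn.locallyIntegrableOn h

lemma IsPrimitive.hasWeakDeriv {G g : ℝ → ℝ} (hG : IsPrimitive G g) : HasWeakDeriv G g :=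
  ⟨hG.locallyIntegrableOn,
    locallyIntegrableOn_of_integrable (integrable_iff_intervalIntegrable.2 hG.integrable),
    fun _ hφ => hG.integral_mul_deriv_test hφ⟩

/-- A function with integrable weak derivative has an absolutely continuous representative. -/
lemma HasWeakDeriv.exists_isPrimitive {g g' : ℝ → ℝ} (h : HasWeakDeriv g g')
    (hi : Integrable g' muOmega) : ∃ G, IsPrimitive G g' ∧ g =ᵐ[muOmega] G := by
  have hW := IsPrimitive.of_integrable hi 0
  -- The difference of `g` and an integral of `g'` has weak derivative zero.
  obtain ⟨k, hk⟩ := ae_eq_const_of_integral_mul_deriv (h.locInt.sub hW.locallyIntegrableOn) (by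
    intro φ hφ
    have i1 := hφ.deriv.integrable_mul h.locInt
    have i2 := hφ.deriv.integrable_mul hW.locallyIntegrableOn
    have e := integral_sub i1 i2
    simp only [← sub_mul] at e
    refine e.trans ?_
    have e1 := h.parts φ hφ
    have e2 := hW.integral_mul_deriv_test hφ
    exact sub_eq_zero.2 (e1.trans e2.symm))
  refine ⟨_, IsPrimitive.of_integrable hi k, ?_⟩
  filter_upwards [hk] with x hx
  have : g x - (0 + ∫ t in (0 : ℝ)..x, g' t) = k := hx
  linarith

/-! ### Poincaré inequality and characterization of `H¹₀` -/

lemma IsPrimitive.abs_sub_le {F f : ℝ → ℝ} (h : IsPrimitive F f) {s t : ℝ}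
    (hs : s ∈ Set.Icc (0 : ℝ) 1) (ht : t ∈ Set.Icc (0 : ℝ) 1) (hst : s ≤ t) :
    |F t - F s| ≤ ∫ x in s..t, |f x| := by
  rw [h.sub_eq hs ht]
  exact intervalIntegral.abs_integral_le_integral_abs hst

/-- `|F x| ≤ ∫ |f|`, and the `L¹` norm is below the `L²` norm because `Ω` has measure one. This is
the Poincaré inequality with constant 1. -/
lemma IsPrimitive.enorm_le {F f : ℝ → ℝ} (h : IsPrimitive F f) (h0 : F 0 = 0) {x : ℝ}
    (hx : x ∈ Set.Icc (0 : ℝ) 1) : ‖F x‖ₑ ≤ eLpNorm f 2 muOmega := by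
  have hm : AEStronglyMeasurable f muOmega :=
    (integrable_iff_intervalIntegrable.2 h.integrable).aestronglyMeasurable
  have h1 : ‖F x‖ₑ ≤ eLpNorm f 1 muOmega := by
    rw [h.eq x hx, h0, zero_add, intervalIntegral.integral_of_le hx.1,
      eLpNorm_one_eq_lintegral_enorm, muOmega_eq_restrict_Ioc]
    exact (enorm_integral_le_lintegral_enorm _).trans
      (lintegral_mono_set (Set.Ioc_subset_Ioc_right hx.2))
  exact h1.trans (eLpNorm_le_eLpNorm_of_exponent_le (by norm_num) hm)

lemma IsPrimitive.eLpNorm_le {F f : ℝ → ℝ} (h : IsPrimitive F f) (h0 : F 0 = 0) :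
    eLpNorm F 2 muOmega ≤ eLpNorm f 2 muOmega := by
  have hb : ∀ᵐ x ∂muOmega, ‖F x‖ₑ ≤ eLpNorm f 2 muOmega := by
    filter_upwards [ae_muOmega_mem] with x hx using h.enorm_le h0 hx
  by_cases ht : eLpNorm f 2 muOmega = ⊤
  · rw [ht]; exact le_top
  lift eLpNorm f 2 muOmega to NNReal using ht with C
  refine (eLpNorm_le_of_ae_enorm_bound hb).trans ?_
  simp

/-- An `H¹₀` function has an absolutely continuous representative vanishing at both ends. -/
lemma MemH10.exists_isPrimitive {v v' : ℝ → ℝ} (h : MemH10 v v') :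
    ∃ V, IsPrimitive V v' ∧ V 0 = 0 ∧ V 1 = 0 ∧ v =ᵐ[muOmega] V := by
  obtain ⟨φ, hφ, hv, hv'⟩ := h.approx
  have hi : Integrable v' muOmega := h.memH1.memLp_deriv.integrable (by norm_num)
  have hV := IsPrimitive.of_integrable hi 0
  set V : ℝ → ℝ := fun x => 0 + ∫ t in (0 : ℝ)..x, v' t with hVdef
  have hV0 : V 0 = 0 := by simp [V]
  have hd : ∀ n, IsPrimitive (fun x => φ n x - V x) (fun x => deriv (φ n) x - v' x) :=
    fun n => (hφ n).isPrimitive.sub hV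
  have hz : ∀ n x, x ∉ Omega → φ n x = 0 := fun n x hx => (hφ n).eq_zero hx
  have hd0 : ∀ n, φ n 0 - V 0 = 0 := fun n => by rw [hz n 0 (by simp [Omega]), hV0, sub_zero]
  refine ⟨V, hV, hV0, ?_, ?_⟩
  · have h1 : ‖V 1‖ₑ ≤ 0 := by
      refine ge_of_tendsto' hv' fun n => ?_
      have := (hd n).enorm_le (hd0 n) (x := 1) (by simp)
      simpa [hz n 1 (by simp [Omega])] using this
    simpa using h1
  · have hVm : AEStronglyMeasurable V muOmega :=
      ((hV.continuousOn.integrableOn_Icc).mono_set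
        Set.Ioo_subset_Icc_self).aestronglyMeasurable
    -- By Poincaré `φ n` converges in `L²` to `V` as well as to `v`, so the two agree almost
    -- everywhere.
    have hle : ∀ n, eLpNorm (fun x => v x - V x) 2 muOmega ≤
        eLpNorm (fun x => φ n x - v x) 2 muOmega +
          eLpNorm (fun x => deriv (φ n) x - v' x) 2 muOmega := by
      intro n
      have hφm : AEStronglyMeasurable (φ n) muOmega :=
        (hφ n).smooth.continuous.aestronglyMeasurable
      have hvm := h.memH1.memLp.aestronglyMeasurable
      have e : (fun x => v x - V x) = (fun x => φ n x - V x) - (fun x => φ n x - v x) := by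
        ext x; simp
      rw [e, add_comm]
      refine (eLpNorm_sub_le (hφm.sub hVm) (hφm.sub hvm) (by norm_num)).trans ?_
      exact add_le_add ((hd n).eLpNorm_le (hd0 n)) le_rfl
    have h0 : eLpNorm (fun x => v x - V x) 2 muOmega = 0 := by
      have ht := hv.add hv'
      rw [add_zero] at ht
      exact le_antisymm (ge_of_tendsto' ht hle) (zero_le)
    filter_upwards [(eLpNorm_eq_zero_iff (f := fun x => v x - V x)
      (h.memH1.memLp.aestronglyMeasurable.sub hVm) two_ne_zero).1 h0] with x hx
    exact sub_eq_zero.1 hx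

lemma IsTest.memLp {φ : ℝ → ℝ} (h : IsTest φ) : MemLp φ 2 muOmega :=
  (h.smooth.continuous.memLp_of_hasCompactSupport h.compact).restrict _

/-- The derivatives of test functions, as a subspace of `L²(Ω)`. -/
def testDerivs : Submodule ℝ (Lp ℝ 2 muOmega) where
  carrier := {f | ∃ φ, IsTest φ ∧ f =ᵐ[muOmega] deriv φ}
  add_mem' := by
    rintro f g ⟨φ, hφ, hf⟩ ⟨ψ, hψ, hg⟩
    refine ⟨fun x => φ x + ψ x, hφ.add hψ, ?_⟩
    filter_upwards [Lp.coeFn_add f g, hf, hg] with x h1 h2 h3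
    rw [h1, Pi.add_apply, h2, h3]
    exact (deriv_fun_add (hφ.smooth.differentiable (by simp) x)
      (hψ.smooth.differentiable (by simp) x)).symm
  zero_mem' := by
    refine ⟨fun _ => 0, ⟨contDiff_const, .zero, by simp [tsupport, Function.support]⟩, ?_⟩
    filter_upwards [Lp.coeFn_zero ℝ 2 muOmega] with x _
    simp
  smul_mem' := by
    rintro k f ⟨φ, hφ, hf⟩
    refine ⟨fun x => k * φ x, hφ.const_mul k, ?_⟩
    filter_upwards [Lp.coeFn_smul k f, hf] with x h1 h2
    rw [h1, Pi.smul_apply, h2, deriv_const_mul_field]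
    rfl

/-- The derivatives of test functions are dense among the mean-zero functions of `L²`: a function
orthogonal to all of them is constant by du Bois-Reymond, hence orthogonal to `v'`. Poincaré then
turns convergence of the derivatives into convergence of the functions. -/
lemma IsPrimitive.memH10 {V v' : ℝ → ℝ} (h : IsPrimitive V v') (h0 : V 0 = 0) (h1 : V 1 = 0)
    (hv' : MemLp v' 2 muOmega) : MemH10 V v' := by
  have hVm : AEStronglyMeasurable V muOmega :=
    ((h.continuousOn.integrableOn_Icc).mono_set Set.Ioo_subset_Icc_self).aestronglyMeasurable
  have hV2 : MemLp V 2 muOmega := ⟨hVm, (h.eLpNorm_le h0).trans_lt hv'.2⟩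
  refine ⟨⟨h.hasWeakDeriv, hV2, hv'⟩, ?_⟩
  have hint : ∫ x in Omega, v' x = 0 := by
    rw [integral_Omega, ← h.sub_eq (by simp) (by simp), h0, h1, sub_zero]
  have hmem : hv'.toLp v' ∈ testDerivs.topologicalClosure := by
    rw [← Submodule.orthogonal_orthogonal_eq_closure, Submodule.mem_orthogonal]
    intro g hg
    have hgi : Integrable g muOmega := (Lp.memLp g).integrable (by norm_num)
    obtain ⟨k, hk⟩ := ae_eq_const_of_integral_mul_deriv
      (locallyIntegrableOn_of_integrable hgi) (by
      intro φ hφ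
      have hm : hφ.deriv.memLp.toLp _ ∈ testDerivs := ⟨φ, hφ, MemLp.coeFn_toLp _⟩
      have := (Submodule.mem_orthogonal _ _).1 hg _ hm
      rw [L2.inner_def] at this
      rw [← this]
      apply integral_congr_ae
      filter_upwards [MemLp.coeFn_toLp hφ.deriv.memLp] with x hx
      rw [hx]
      simp)
    rw [L2.inner_def]
    have : ∫ x, inner ℝ (g x) (hv'.toLp v' x) ∂muOmega = ∫ x, k * v' x ∂muOmega := by
      apply integral_congr_ae
      filter_upwards [MemLp.coeFn_toLp hv', hk] with x hx hx2
      rw [hx, hx2]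
      simp [mul_comm]
    rw [this, integral_const_mul]
    have e : ∫ x, v' x ∂muOmega = 0 := hint
    rw [e, mul_zero]
  obtain ⟨F, hF, hlim⟩ := mem_closure_iff_seq_limit.1 hmem
  choose φ hφ hFφ using hF
  have hconv : Tendsto (fun n => eLpNorm (fun x => deriv (φ n) x - v' x) 2 muOmega) atTop
      (𝓝 0) := by
    rw [Lp.tendsto_Lp_iff_tendsto_eLpNorm'] at hlim
    refine hlim.congr fun n => eLpNorm_congr_ae ?_
    filter_upwards [hFφ n, MemLp.coeFn_toLp hv'] with x hx hx2
    rw [Pi.sub_apply, hx, hx2]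
  refine ⟨φ, hφ, ?_, hconv⟩
  refine tendsto_of_tendsto_of_tendsto_of_le_of_le tendsto_const_nhds hconv
    (fun _ => zero_le) fun n => ?_
  refine ((hφ n).isPrimitive.sub h).eLpNorm_le ?_
  rw [(hφ n).eq_zero (x := 0) (by simp [Omega]), h0, sub_zero]

/-! ### Meshes, hat functions and piecewise linear functions -/

namespace Mesh

variable {N : ℕ} (m : Mesh N)

lemma h_pos {i : ℕ} (hi : i < N) : 0 < m.h i := sub_pos.2 (m.x_lt i hi)

lemma x_mono {i j : ℕ} (hij : i ≤ j) (hj : j ≤ N) : m.x i ≤ m.x j := by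
  induction j, hij using Nat.le_induction with
  | base => exact le_rfl
  | succ k _ ih => exact (ih (by omega)).trans (m.x_lt k (by omega)).le

lemma x_mem {i : ℕ} (hi : i ≤ N) : m.x i ∈ Set.Icc (0 : ℝ) 1 :=
  ⟨m.x_zero ▸ m.x_mono (Nat.zero_le i) hi, m.x_last ▸ m.x_mono hi le_rfl⟩

lemma pos {N : ℕ} (m : Mesh N) : 0 < N := by
  rcases Nat.eq_zero_or_pos N with h | h
  · have e : m.x N = m.x 0 := congrArg m.x h
    rw [m.x_last, m.x_zero] at e
    exact absurd e one_ne_zero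
  · exact h

lemma sum_h : ∑ i ∈ Finset.range N, m.h i = 1 := by
  have := Finset.sum_range_sub m.x N
  rw [m.x_zero, m.x_last, sub_zero] at this
  exact this

lemma Icc_subset {i : ℕ} (hi : i < N) : Set.Icc (m.x i) (m.x (i + 1)) ⊆ Set.Icc 0 1 :=
  Set.Icc_subset_Icc (m.x_mem hi.le).1 (m.x_mem (i := i + 1) hi).2

lemma Ioo_subset {i : ℕ} (hi : i < N) : Set.Ioo (m.x i) (m.x (i + 1)) ⊆ Omega :=
  Set.Ioo_subset_Ioo (m.x_mem hi.le).1 (m.x_mem (i := i + 1) hi).2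

lemma integral_cell {i : ℕ} (hi : i < N) (g : ℝ → ℝ) :
    ∫ x in Set.Ioo (m.x i) (m.x (i + 1)), g x = ∫ x in (m.x i)..(m.x (i + 1)), g x := by
  rw [intervalIntegral.integral_of_le (m.x_lt i hi).le, integral_Ioc_eq_integral_Ioo]

lemma sum_integral {g : ℝ → ℝ} (hg : Integrable g muOmega) :
    ∑ i ∈ Finset.range N, ∫ x in Set.Ioo (m.x i) (m.x (i + 1)), g x = ∫ x in Omega, g x := by
  have hi := integrable_iff_intervalIntegrable.1 hg
  rw [integral_Omega, ← m.x_zero, ← m.x_last,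
    ← intervalIntegral.sum_integral_adjacent_intervals
      (fun k hk => intervalIntegrable_sub hi (m.x_mem hk.le) (m.x_mem (i := k + 1) hk))]
  exact Finset.sum_congr rfl fun i hi => m.integral_cell (Finset.mem_range.1 hi) g

lemma exists_cell {t : ℝ} (h0 : 0 ≤ t) (h1 : t < 1) :
    ∃ i < N, t ∈ Set.Ico (m.x i) (m.x (i + 1)) := by
  have key : ∀ n ≤ N, t < m.x n → ∃ i < n, t ∈ Set.Ico (m.x i) (m.x (i + 1)) := by
    intro n
    induction n with
    | zero =>
      intro _ h
      rw [m.x_zero] at h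
      exact absurd h h0.not_gt
    | succ k ih =>
      intro hk h
      by_cases hc : t < m.x k
      · obtain ⟨i, hi, hh⟩ := ih (by omega) hc
        exact ⟨i, by omega, hh⟩
      · exact ⟨k, by omega, not_lt.1 hc, h⟩
  exact key N le_rfl (by rwa [m.x_last])

lemma hat_of_le {i : ℕ} (hi : i + 1 < N) {t : ℝ} (ht : t ≤ m.x i) : m.hat i t = 0 := by
  apply max_eq_left
  exact (min_le_left _ _).trans
    (div_nonpos_of_nonpos_of_nonneg (sub_nonpos.2 ht) (m.h_pos (by omega)).le)

lemma hat_of_ge {i : ℕ} (hi : i + 1 < N) {t : ℝ} (ht : m.x (i + 2) ≤ t) : m.hat i t = 0 := by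
  apply max_eq_left
  exact (min_le_right _ _).trans
    (div_nonpos_of_nonpos_of_nonneg (sub_nonpos.2 ht) (m.h_pos hi).le)

lemma hat_left {i : ℕ} (hi : i + 1 < N) {t : ℝ} (ht : t ∈ Set.Icc (m.x i) (m.x (i + 1))) :
    m.hat i t = (t - m.x i) / m.h i := by
  have h1 := m.h_pos (i := i) (by omega)
  have h2 := m.h_pos hi
  have e1 : (t - m.x i) / m.h i ≤ 1 := by
    rw [div_le_one h1, h]; linarith [ht.2]
  have e2 : 1 ≤ (m.x (i + 2) - t) / m.h (i + 1) := by
    rw [one_le_div h2, h]; linarith [ht.2]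
  rw [hat, min_eq_left (e1.trans e2), max_eq_right]
  exact div_nonneg (sub_nonneg.2 ht.1) h1.le

lemma hat_right {i : ℕ} (hi : i + 1 < N) {t : ℝ}
    (ht : t ∈ Set.Icc (m.x (i + 1)) (m.x (i + 2))) :
    m.hat i t = (m.x (i + 2) - t) / m.h (i + 1) := by
  have h1 := m.h_pos (i := i) (by omega)
  have h2 := m.h_pos hi
  have e1 : (m.x (i + 2) - t) / m.h (i + 1) ≤ 1 := by
    rw [div_le_one h2, h]; linarith [ht.1]
  have e2 : 1 ≤ (t - m.x i) / m.h i := by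
    rw [one_le_div h1, h]; linarith [ht.1]
  rw [hat, min_eq_right (e1.trans e2), max_eq_right]
  exact div_nonneg (sub_nonneg.2 ht.2) h2.le

lemma hat_node_self {i : ℕ} (hi : i + 1 < N) : m.hat i (m.x (i + 1)) = 1 := by
  rw [m.hat_left hi ⟨(m.x_lt i (by omega)).le, le_rfl⟩]
  exact div_self (m.h_pos (by omega)).ne'

lemma hat_node_ne {i j : ℕ} (hi : i + 1 < N) (hj : j ≤ N) (hij : i + 1 ≠ j) :
    m.hat i (m.x j) = 0 := by
  rcases lt_or_ge j (i + 1) with h | h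
  · exact m.hat_of_le hi (m.x_mono (by omega) (by omega))
  · exact m.hat_of_ge hi (m.x_mono (by omega) hj)

/-- `v` is continuous, affine with slope `s i` on the `i`-th cell, and vanishes at both ends. -/
structure IsPL (v : ℝ → ℝ) (s : ℕ → ℝ) : Prop where
  cont : Continuous v
  zero : v 0 = 0
  one : v 1 = 0
  affine : ∀ i < N, ∀ t ∈ Set.Icc (m.x i) (m.x (i + 1)), v t = v (m.x i) + s i * (t - m.x i)

lemma isPL_hat {i : ℕ} (hi : i + 1 < N) : ∃ s, m.IsPL (m.hat i) s := by
  refine ⟨fun k => if k = i then 1 / m.h i else if k = i + 1 then - (1 / m.h (i + 1)) else 0,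
    ?_, ?_, ?_, ?_⟩
  · unfold hat; fun_prop
  · exact m.hat_of_le hi (m.x_mem (by omega)).1
  · exact m.hat_of_ge hi (m.x_mem (by omega)).2
  · intro k hk t ht
    have hl : m.x k ∈ Set.Icc (m.x k) (m.x (k + 1)) := ⟨le_rfl, (m.x_lt k hk).le⟩
    by_cases h1 : k = i
    · subst h1
      rw [m.hat_left hi ht, m.hat_left hi hl, if_pos rfl]
      ring
    rw [if_neg h1]
    by_cases h2 : k = i + 1
    · subst h2
      rw [m.hat_right hi ht, m.hat_right hi hl, if_pos rfl]
      ring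
    rw [if_neg h2, zero_mul, add_zero]
    rcases lt_or_gt_of_ne h1 with h | h
    · have := m.x_mono (i := k + 1) (j := i) (by omega) (by omega)
      rw [m.hat_of_le hi (ht.2.trans this), m.hat_of_le hi (hl.2.trans this)]
    · have := m.x_mono (i := i + 2) (j := k) (by omega) (by omega)
      rw [m.hat_of_ge hi (this.trans ht.1), m.hat_of_ge hi this]

/-- Only this inclusion is needed; the interpolant is written directly as a combination of hat
functions. -/
lemma isPL_of_mem {v : ℝ → ℝ} (hv : v ∈ m.feSpace) : ∃ s, m.IsPL v s := by
  induction hv using Submodule.span_induction with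
  | mem v hv =>
    obtain ⟨i, hi, rfl⟩ := hv
    exact m.isPL_hat hi
  | zero => exact ⟨0, continuous_const, rfl, rfl, fun i _ t _ => by simp⟩
  | add v w _ _ hv hw =>
    obtain ⟨s, hs⟩ := hv
    obtain ⟨r, hr⟩ := hw
    refine ⟨s + r, hs.cont.add hr.cont, by simp [hs.zero, hr.zero], by simp [hs.one, hr.one], ?_⟩
    intro i hi t ht
    simp only [Pi.add_apply]
    rw [hs.affine i hi t ht, hr.affine i hi t ht]
    ring
  | smul k v _ hv =>
    obtain ⟨s, hs⟩ := hv
    refine ⟨k • s, hs.cont.const_smul k, by simp [hs.zero], by simp [hs.one], ?_⟩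
    intro i hi t ht
    simp only [Pi.smul_apply, smul_eq_mul]
    rw [hs.affine i hi t ht]
    ring

lemma exists_interpolant {E : ℝ → ℝ} (h0 : E 0 = 0) (h1 : E 1 = 0) :
    ∃ v ∈ m.feSpace, ∀ j ≤ N, v (m.x j) = E (m.x j) := by
  -- `hat i` belongs to the node `i + 1`, so the interior nodes correspond to `i < N - 1`. At the
  -- two end nodes `E` vanishes.
  refine ⟨∑ i ∈ Finset.range (N - 1), E (m.x (i + 1)) • m.hat i, ?_, ?_⟩
  · refine Submodule.sum_mem _ fun i hi => Submodule.smul_mem _ _ (Submodule.subset_span ?_)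
    exact ⟨i, by have := Finset.mem_range.1 hi; omega, rfl⟩
  · intro j hj
    rw [Finset.sum_apply]
    simp only [Pi.smul_apply, smul_eq_mul]
    have hlt : ∀ i ∈ Finset.range (N - 1), i + 1 < N := fun i hi => by
      have := Finset.mem_range.1 hi; omega
    by_cases hj0 : j = 0
    · subst hj0
      rw [m.x_zero, h0]
      refine Finset.sum_eq_zero fun i hi => ?_
      rw [m.hat_of_le (hlt i hi) (m.x_mem (by have := hlt i hi; omega)).1, mul_zero]
    by_cases hjN : j = N
    · rw [hjN, m.x_last, h1]
      refine Finset.sum_eq_zero fun i hi => ?_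
      rw [m.hat_of_ge (hlt i hi) (m.x_mem (hlt i hi)).2, mul_zero]
    obtain ⟨k, rfl⟩ := Nat.exists_eq_succ_of_ne_zero hj0
    rw [Finset.sum_eq_single k]
    · rw [m.hat_node_self (by omega), mul_one]
    · intro i hi hik
      rw [m.hat_node_ne (hlt i hi) hj (by omega), mul_zero]
    · intro hk
      exact absurd (Finset.mem_range.2 (by omega)) hk

namespace IsPL

variable {m} {v : ℝ → ℝ} {s : ℕ → ℝ}

lemma hasDerivAt (hv : m.IsPL v s) {i : ℕ} (hi : i < N) {t : ℝ}
    (ht : t ∈ Set.Ioo (m.x i) (m.x (i + 1))) : HasDerivAt v (s i) t := by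
  have h1 : HasDerivAt (fun t => v (m.x i) + s i * (t - m.x i)) (s i) t := by
    simpa using (((hasDerivAt_id t).sub_const (m.x i)).const_mul (s i)).const_add (v (m.x i))
  refine h1.congr_of_eventuallyEq ?_
  filter_upwards [isOpen_Ioo.mem_nhds ht] with y hy
  exact hv.affine i hi y (Set.Ioo_subset_Icc_self hy)

/-- Excluding all of `range m.x`, with its arbitrary values beyond index `N`, costs only a countable
set. -/
lemma hasDerivAt_deriv (hv : m.IsPL v s) {t : ℝ} (ht : t ∈ Set.Icc (0 : ℝ) 1)
    (hn : t ∉ Set.range m.x) : HasDerivAt v (deriv v t) t ∧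
      |deriv v t| ≤ ∑ i ∈ Finset.range N, |s i| := by
  have h1 : t < 1 := lt_of_le_of_ne ht.2 fun h => hn ⟨N, m.x_last.trans h.symm⟩
  obtain ⟨i, hi, hm⟩ := m.exists_cell ht.1 h1
  have hm' : t ∈ Set.Ioo (m.x i) (m.x (i + 1)) :=
    ⟨lt_of_le_of_ne hm.1 fun h => hn ⟨i, h⟩, hm.2⟩
  have hd := hv.hasDerivAt hi hm'
  rw [hd.deriv]
  exact ⟨hd, Finset.single_le_sum (f := fun i => |s i|) (fun _ _ => abs_nonneg _)
    (Finset.mem_range.2 hi)⟩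

lemma memLp_deriv (hv : m.IsPL v s) (p : ENNReal) : MemLp (deriv v) p muOmega := by
  refine MemLp.of_bound (measurable_deriv v).aestronglyMeasurable
    (∑ i ∈ Finset.range N, |s i|) ?_
  have hn : ∀ᵐ x ∂muOmega, x ∉ Set.range m.x :=
    ae_restrict_of_ae ((Set.countable_range m.x).ae_notMem volume)
  filter_upwards [ae_muOmega_mem, hn] with x hx hx2
  exact (hv.hasDerivAt_deriv hx hx2).2

lemma isPrimitive (hv : m.IsPL v s) : IsPrimitive v (deriv v) := by
  have hi : IntervalIntegrable (deriv v) volume 0 1 :=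
    integrable_iff_intervalIntegrable.1 (memLp_one_iff_integrable.1 (hv.memLp_deriv 1))
  refine ⟨hi, fun x hx => ?_⟩
  rw [integral_eq_of_hasDerivAt_off_countable_of_le v (deriv v) hx.1
    (Set.countable_range m.x) hv.cont.continuousOn
    (fun t ht => (hv.hasDerivAt_deriv ⟨ht.1.1.le, ht.1.2.le.trans hx.2⟩ ht.2).1)
    (intervalIntegrable_sub hi (by simp) hx)]
  ring

lemma memH10 (hv : m.IsPL v s) : MemH10 v (deriv v) :=
  hv.isPrimitive.memH10 hv.zero hv.one (hv.memLp_deriv 2)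

end IsPL

end Mesh

/-! ### `L²` inequalities, the bilinear form and coercivity -/

section L2

variable {μ : Measure ℝ} {f g : ℝ → ℝ}

lemma toReal_eLpNorm_two (hf : MemLp f 2 μ) :
    (eLpNorm f 2 μ).toReal = √(∫ x, |f x| ^ 2 ∂μ) := by
  rw [hf.eLpNorm_eq_integral_rpow_norm two_ne_zero ENNReal.ofNat_ne_top, ENNReal.toReal_ofReal
    (by positivity), Real.sqrt_eq_rpow]
  simp

lemma integrable_abs_sq (hf : MemLp f 2 μ) : Integrable (fun x => |f x| ^ 2) μ := by
  simpa using hf.integrable_sq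

lemma sqrt_integral_sq_add_le (hf : MemLp f 2 μ) (hg : MemLp g 2 μ) :
    √(∫ x, |f x + g x| ^ 2 ∂μ) ≤ √(∫ x, |f x| ^ 2 ∂μ) + √(∫ x, |g x| ^ 2 ∂μ) := by
  have h := toReal_eLpNorm_two (hf.add hg)
  simp only [Pi.add_apply] at h
  rw [← toReal_eLpNorm_two hf, ← toReal_eLpNorm_two hg, ← h,
    ← ENNReal.toReal_add hf.eLpNorm_ne_top hg.eLpNorm_ne_top]
  exact ENNReal.toReal_mono (ENNReal.add_ne_top.2 ⟨hf.eLpNorm_ne_top, hg.eLpNorm_ne_top⟩)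
    (eLpNorm_add_le hf.aestronglyMeasurable hg.aestronglyMeasurable (by norm_num))

lemma integral_abs_mul_le (hf : MemLp f 2 μ) (hg : MemLp g 2 μ) :
    ∫ x, |f x| * |g x| ∂μ ≤ √(∫ x, |f x| ^ 2 ∂μ) * √(∫ x, |g x| ^ 2 ∂μ) := by
  have h := integral_mul_le_Lp_mul_Lq_of_nonneg (μ := μ) (p := 2) (q := 2)
    (f := fun x => |f x|) (g := fun x => |g x|) Real.HolderConjugate.two_two
    (Eventually.of_forall fun _ => abs_nonneg _) (Eventually.of_forall fun _ => abs_nonneg _)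
    (by rw [ENNReal.ofReal_ofNat]; exact hf.abs) (by rw [ENNReal.ofReal_ofNat]; exact hg.abs)
  simpa [Real.sqrt_eq_rpow] using h

lemma integral_abs_le [IsFiniteMeasure μ] (hf : MemLp f 2 μ) :
    ∫ x, |f x| ∂μ ≤ √(μ.real Set.univ) * √(∫ x, |f x| ^ 2 ∂μ) := by
  have h := integral_abs_mul_le hf (memLp_const (μ := μ) (1 : ℝ))
  rw [mul_comm]
  simpa using h

lemma memLp_bdd_mul (hf : MemLp f ⊤ μ) (hg : MemLp g 2 μ) :
    MemLp (fun x => f x * g x) 2 μ :=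
  hg.mul' hf

lemma integrable_mul_of_memLp_two (hf : MemLp f 2 μ) (hg : MemLp g 2 μ) :
    Integrable (fun x => f x * g x) μ :=
  hf.integrable_mul hg

end L2

lemma IsPrimitive.memLp {F f : ℝ → ℝ} (h : IsPrimitive F f) (p : ENNReal) :
    MemLp F p muOmega := by
  obtain ⟨C, hC⟩ := isCompact_Icc.exists_bound_of_continuousOn h.continuousOn
  refine MemLp.of_bound ((h.continuousOn.integrableOn_Icc).mono_set
    Set.Ioo_subset_Icc_self).aestronglyMeasurable C ?_
  filter_upwards [ae_muOmega_mem] with x hx using hC x hx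

section Bilinear

variable {a b c u u' u₂ u₂' v v' v₂ v₂' : ℝ → ℝ}

lemma integrable_bform (ha : MemLp a ⊤ muOmega) (hb : MemLp b ⊤ muOmega)
    (hc : MemLp c ⊤ muOmega) (hu : MemLp u 2 muOmega) (hu' : MemLp u' 2 muOmega)
    (hv : MemLp v 2 muOmega) (hv' : MemLp v' 2 muOmega) :
    Integrable (fun x => a x * u' x * v' x + b x * u' x * v x + c x * u x * v x) muOmega :=
  ((integrable_mul_of_memLp_two (memLp_bdd_mul ha hu') hv').add
    (integrable_mul_of_memLp_two (memLp_bdd_mul hb hu') hv)).add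
    (integrable_mul_of_memLp_two (memLp_bdd_mul hc hu) hv)

lemma bform_sub_left (ha : MemLp a ⊤ muOmega) (hb : MemLp b ⊤ muOmega)
    (hc : MemLp c ⊤ muOmega) (hu : MemLp u 2 muOmega) (hu' : MemLp u' 2 muOmega)
    (hu₂ : MemLp u₂ 2 muOmega) (hu₂' : MemLp u₂' 2 muOmega)
    (hv : MemLp v 2 muOmega) (hv' : MemLp v' 2 muOmega) :
    bform a b c (fun x => u x - u₂ x) (fun x => u' x - u₂' x) v v' =
      bform a b c u u' v v' - bform a b c u₂ u₂' v v' := by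
  refine Eq.trans ?_ (integral_sub (integrable_bform ha hb hc hu hu' hv hv')
    (integrable_bform ha hb hc hu₂ hu₂' hv hv'))
  exact integral_congr_ae (Eventually.of_forall fun x => by simp only; ring)

lemma bform_sub_right (ha : MemLp a ⊤ muOmega) (hb : MemLp b ⊤ muOmega)
    (hc : MemLp c ⊤ muOmega) (hu : MemLp u 2 muOmega) (hu' : MemLp u' 2 muOmega)
    (hv : MemLp v 2 muOmega) (hv' : MemLp v' 2 muOmega)
    (hv₂ : MemLp v₂ 2 muOmega) (hv₂' : MemLp v₂' 2 muOmega) :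
    bform a b c u u' (fun x => v x - v₂ x) (fun x => v' x - v₂' x) =
      bform a b c u u' v v' - bform a b c u u' v₂ v₂' := by
  refine Eq.trans ?_ (integral_sub (integrable_bform ha hb hc hu hu' hv hv')
    (integrable_bform ha hb hc hu hu' hv₂ hv₂'))
  exact integral_congr_ae (Eventually.of_forall fun x => by simp only; ring)

lemma bform_congr_left (h : u =ᵐ[muOmega] u₂) :
    bform a b c u u' v v' = bform a b c u₂ u' v v' := by
  refine integral_congr_ae ?_
  filter_upwards [h] with x hx
  rw [hx]

end Bilinear

lemma memLp_residual {a' b c f v v' : ℝ → ℝ} (ha' : MemLp a' ⊤ muOmega)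
    (hb : MemLp b ⊤ muOmega) (hc : MemLp c ⊤ muOmega) (hf : MemLp f 2 muOmega)
    (hv : MemLp v 2 muOmega) (hv' : MemLp v' 2 muOmega) :
    MemLp (residual a' b c f v v') 2 muOmega :=
  ((hf.add (memLp_bdd_mul ha' hv')).sub (memLp_bdd_mul hb hv')).sub (memLp_bdd_mul hc hv)

/-- Coercivity of the bilinear form on `H¹₀`. -/
lemma IsElliptic.coercive {a a' b b' c : ℝ → ℝ} {a₀ : ℝ} (hcoef : IsElliptic a a' b b' c a₀)
    {E e : ℝ → ℝ} (hE : IsPrimitive E e) (h0 : E 0 = 0) (h1 : E 1 = 0)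
    (he : MemLp e 2 muOmega) : a₀ * ∫ x in Omega, |e x| ^ 2 ≤ bform a b c E e E e := by
  obtain ⟨β, hβ, hbβ⟩ := hcoef.memB.weak.exists_isPrimitive
    (hcoef.memB.memLp_deriv.integrable le_top)
  have hEE := hE.mul hE
  have hz := hβ.integral_mul_add hEE (s := 0) (t := 1) (by simp) (by simp)
  simp only [h0, h1, mul_zero, sub_zero] at hz
  rw [← integral_Omega] at hz
  have hi := integrable_iff_intervalIntegrable.2 (hβ.mul hEE).integrable
  have hB := integrable_bform hcoef.memA.memLp hcoef.memB.memLp hcoef.memC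
    (hE.memLp 2) he (hE.memLp 2) he
  -- Subtracting half of the vanishing integral of `(β E²)'` trades `b e E` for `-b' E² / 2`; what
  -- remains is `a e² + (c - b'/2) E²`.
  have e1 : bform a b c E e E e =
      ∫ x, ((a x * e x * e x + b x * e x * E x + c x * E x * E x) -
        1 / 2 * (b' x * (E x * E x) + β x * (e x * E x + E x * e x))) ∂muOmega := by
    rw [integral_sub hB (hi.const_mul _), integral_const_mul]
    have : ∫ x, (b' x * (E x * E x) + β x * (e x * E x + E x * e x)) ∂muOmega = 0 := hz
    rw [this, mul_zero, sub_zero]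
    rfl
  rw [e1, ← integral_const_mul]
  refine integral_mono_ae ((integrable_abs_sq he).const_mul a₀) (hB.sub (hi.const_mul _)) ?_
  filter_upwards [hbβ, hcoef.lower, hcoef.nonneg] with x hx1 hx2 hx3
  rw [← hx1, sq_abs]
  nlinarith [mul_le_mul_of_nonneg_right hx2 (sq_nonneg (e x)),
    mul_nonneg hx3 (sq_nonneg (E x))]

/-! ### The a posteriori error estimate -/

namespace Mesh

variable {N : ℕ} (m : Mesh N)

lemma memLp_cell {i : ℕ} (hi : i < N) {f : ℝ → ℝ} {p : ENNReal} (hf : MemLp f p muOmega) :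
    MemLp f p (volume.restrict (Set.Ioo (m.x i) (m.x (i + 1)))) :=
  hf.mono_measure (Measure.restrict_mono_set _ (m.Ioo_subset hi))

lemma avg_nonneg (w : ℝ → ℝ) (i : ℕ) : 0 ≤ m.avg w i := Real.sqrt_nonneg _

lemma h_mul_avg_sq {i : ℕ} (hi : i < N) (w : ℝ → ℝ) :
    m.h i * m.avg w i ^ 2 = ∫ x in Set.Ioo (m.x i) (m.x (i + 1)), |w x| ^ 2 := by
  have h1 := m.h_pos hi
  have h2 : 0 ≤ ∫ x in Set.Ioo (m.x i) (m.x (i + 1)), |w x| ^ 2 :=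
    integral_nonneg fun _ => by positivity
  rw [avg, Real.sq_sqrt (by positivity)]
  field_simp

lemma sqrt_h_mul_avg {i : ℕ} (hi : i < N) (w : ℝ → ℝ) :
    √(m.h i) * m.avg w i = √(∫ x in Set.Ioo (m.x i) (m.x (i + 1)), |w x| ^ 2) := by
  rw [← m.h_mul_avg_sq hi, Real.sqrt_mul (m.h_pos hi).le, Real.sqrt_sq (m.avg_nonneg w i)]

lemma measureReal_cell {i : ℕ} (hi : i < N) :
    (volume.restrict (Set.Ioo (m.x i) (m.x (i + 1)))).real Set.univ = m.h i := by
  simp [Measure.real, h, (m.x_lt i hi).le]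

/-- Integration by parts against the derivative of a finite element function. -/
lemma integral_mul_deriv_mul {A a' v W w : ℝ → ℝ} {s : ℕ → ℝ} (hA : IsPrimitive A a')
    (hv : m.IsPL v s) (hW : IsPrimitive W w) (hn : ∀ i ≤ N, W (m.x i) = 0)
    (ha' : MemLp a' ⊤ muOmega) (hw : MemLp w 2 muOmega) :
    ∫ x in Omega, A x * deriv v x * w x = - ∫ x in Omega, a' x * deriv v x * W x := by
  have hv' := hv.memLp_deriv 2
  have i1 : Integrable (fun x => A x * deriv v x * w x) muOmega :=
    integrable_mul_of_memLp_two (memLp_bdd_mul (hA.memLp ⊤) hv') hw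
  have i2 : Integrable (fun x => a' x * deriv v x * W x) muOmega :=
    integrable_mul_of_memLp_two (memLp_bdd_mul ha' hv') (hW.memLp 2)
  -- On a cell `deriv v` is the constant `s i`, so only `A` gets differentiated, and the boundary
  -- terms vanish with `W` at the nodes.
  rw [← m.sum_integral i1, ← m.sum_integral i2, ← Finset.sum_neg_distrib]
  refine Finset.sum_congr rfl fun i hi => ?_
  rw [Finset.mem_range] at hi
  have e1 : ∫ x in Set.Ioo (m.x i) (m.x (i + 1)), A x * deriv v x * w x =
      s i * ∫ x in (m.x i)..(m.x (i + 1)), A x * w x := by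
    rw [← m.integral_cell hi, ← integral_const_mul]
    refine setIntegral_congr_fun measurableSet_Ioo fun x hx => ?_
    rw [(hv.hasDerivAt hi hx).deriv]
    ring
  have e2 : ∫ x in Set.Ioo (m.x i) (m.x (i + 1)), a' x * deriv v x * W x =
      s i * ∫ x in (m.x i)..(m.x (i + 1)), a' x * W x := by
    rw [← m.integral_cell hi, ← integral_const_mul]
    refine setIntegral_congr_fun measurableSet_Ioo fun x hx => ?_
    rw [(hv.hasDerivAt hi hx).deriv]
    ring
  rw [e1, e2, hA.integral_mul hW (m.x_mem hi.le) (m.x_mem (i := i + 1) hi),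
    hn i hi.le, hn (i + 1) hi]
  ring

/-- The error representation by the residual, for functions vanishing at the nodes. -/
lemma load_sub_bform {a a' b b' c f v W w : ℝ → ℝ} {a₀ : ℝ} {s : ℕ → ℝ}
    (hcoef : IsElliptic a a' b b' c a₀) (hf : MemLp f 2 muOmega)
    (hv : m.IsPL v s) (hW : IsPrimitive W w) (hn : ∀ i ≤ N, W (m.x i) = 0)
    (hw : MemLp w 2 muOmega) :
    load f W - bform a b c v (deriv v) W w =
      ∫ x in Omega, residual a' b c f v (deriv v) x * W x := by
  obtain ⟨A, hA, haA⟩ := hcoef.memA.weak.exists_isPrimitive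
    (hcoef.memA.memLp_deriv.integrable le_top)
  have hv' := hv.memLp_deriv 2
  have hv2 := hv.isPrimitive.memLp 2
  have hW2 := hW.memLp 2
  have ha' := hcoef.memA.memLp_deriv
  have key := m.integral_mul_deriv_mul hA hv hW hn ha' hw
  have i0 := integrable_mul_of_memLp_two hf hW2
  have i1 := integrable_mul_of_memLp_two (memLp_bdd_mul (hA.memLp ⊤) hv') hw
  have i2 := integrable_mul_of_memLp_two (memLp_bdd_mul ha' hv') hW2
  have iB := integrable_bform hcoef.memA.memLp hcoef.memB.memLp hcoef.memC hv2 hv' hW2 hw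
  have iR := integrable_mul_of_memLp_two
    (memLp_residual ha' hcoef.memB.memLp hcoef.memC hf hv2 hv') hW2
  have e : ∫ x, (f x * W x - (a x * deriv v x * w x + b x * deriv v x * W x +
      c x * v x * W x)) ∂muOmega = ∫ x, (residual a' b c f v (deriv v) x * W x -
      (A x * deriv v x * w x + a' x * deriv v x * W x)) ∂muOmega := by
    refine integral_congr_ae ?_
    filter_upwards [haA] with x hx
    rw [hx, residual]
    ring
  have hi12 : Integrable (fun x => A x * deriv v x * w x + a' x * deriv v x * W x) muOmega :=
    i1.add i2
  rw [integral_sub i0 iB, integral_sub iR hi12, integral_add i1 i2] at e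
  have key' : ∫ x, A x * deriv v x * w x ∂muOmega = - ∫ x, a' x * deriv v x * W x ∂muOmega := key
  rw [key', neg_add_cancel, sub_zero] at e
  exact e

/-- On a cell, Cauchy-Schwarz costs a factor `√h` for `∫ |e|` and another for `∫ |r|`; a third comes
from `‖r‖_{L²} = √h ⟨r⟩`. A discrete Cauchy-Schwarz inequality then sums the cells. -/
lemma integral_mul_le_sqrt {r E e : ℝ → ℝ} (hr : MemLp r 2 muOmega) (he : MemLp e 2 muOmega)
    (hE : MemLp E 2 muOmega)
    (hb : ∀ i < N, ∀ x ∈ Set.Ioo (m.x i) (m.x (i + 1)),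
      |E x| ≤ 2 * ∫ t in Set.Ioo (m.x i) (m.x (i + 1)), |e t|) :
    ∫ x in Omega, r x * E x ≤ 2 * √(∑ i ∈ Finset.range N, m.h i ^ 3 * m.avg r i ^ 2) *
      √(∫ x in Omega, |e x| ^ 2) := by
  rw [← m.sum_integral (integrable_mul_of_memLp_two hr hE), ← m.sum_integral
    (integrable_abs_sq he)]
  have hcell : ∀ i ∈ Finset.range N, ∫ x in Set.Ioo (m.x i) (m.x (i + 1)), r x * E x ≤
      2 * ((m.h i * √(m.h i) * m.avg r i) *
        √(∫ x in Set.Ioo (m.x i) (m.x (i + 1)), |e x| ^ 2)) := by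
    intro i hi
    rw [Finset.mem_range] at hi
    have hr' := m.memLp_cell hi hr
    have he' := m.memLp_cell hi he
    have hE' := m.memLp_cell hi hE
    have hl1 := integral_abs_le he'
    have hl2 := integral_abs_le hr'
    rw [m.measureReal_cell hi] at hl1 hl2
    rw [← m.sqrt_h_mul_avg hi] at hl2
    set S := ∫ t in Set.Ioo (m.x i) (m.x (i + 1)), |e t|
    have hS : 0 ≤ S := integral_nonneg fun _ => abs_nonneg _
    have h1 : ∫ x in Set.Ioo (m.x i) (m.x (i + 1)), r x * E x ≤
        ∫ x in Set.Ioo (m.x i) (m.x (i + 1)), |r x| * (2 * S) := by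
      refine setIntegral_mono_on (integrable_mul_of_memLp_two hr' hE')
        ((hr'.integrable (by norm_num)).abs.mul_const _) measurableSet_Ioo fun x hx => ?_
      refine (le_abs_self _).trans ?_
      rw [abs_mul]
      exact mul_le_mul_of_nonneg_left (hb i hi x hx) (abs_nonneg _)
    rw [integral_mul_const] at h1
    refine h1.trans ?_
    calc (∫ x in Set.Ioo (m.x i) (m.x (i + 1)), |r x|) * (2 * S)
        ≤ (√(m.h i) * (√(m.h i) * m.avg r i)) * (2 * (√(m.h i) *
          √(∫ x in Set.Ioo (m.x i) (m.x (i + 1)), |e x| ^ 2))) := by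
          have := m.avg_nonneg r i
          gcongr
      _ = _ := by
          have := Real.mul_self_sqrt (m.h_pos hi).le
          linear_combination (2 * √(m.h i) * m.avg r i *
            √(∫ x in Set.Ioo (m.x i) (m.x (i + 1)), |e x| ^ 2)) * this
  refine (Finset.sum_le_sum hcell).trans ?_
  rw [← Finset.mul_sum, mul_assoc]
  refine mul_le_mul_of_nonneg_left ?_ zero_le_two
  refine (Real.sum_mul_le_sqrt_mul_sqrt _ _ _).trans (le_of_eq ?_)
  congr 2
  · refine Finset.sum_congr rfl fun i hi => ?_
    have := Real.sq_sqrt (m.h_pos (Finset.mem_range.1 hi)).le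
    linear_combination (m.h i ^ 2 * m.avg r i ^ 2) * this
  · exact Finset.sum_congr rfl fun i _ => Real.sq_sqrt (integral_nonneg fun _ => by positivity)

/-- Pointwise bound of the interpolation error on a cell. -/
lemma abs_sub_interpolant_le {E e v : ℝ → ℝ} {s : ℕ → ℝ} (hE : IsPrimitive E e)
    (hv : m.IsPL v s) (hn : ∀ j ≤ N, v (m.x j) = E (m.x j)) {i : ℕ} (hi : i < N) {x : ℝ}
    (hx : x ∈ Set.Ioo (m.x i) (m.x (i + 1))) :
    |E x - v x| ≤ 2 * ∫ t in Set.Ioo (m.x i) (m.x (i + 1)), |e t| := by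
  have hl := m.x_lt i hi
  have hxm : x ∈ Set.Icc (0 : ℝ) 1 := m.Icc_subset hi (Set.Ioo_subset_Icc_self hx)
  have h1 := hE.abs_sub_le (m.x_mem hi.le) hxm hx.1.le
  have h2 := hE.abs_sub_le (m.x_mem hi.le) (m.x_mem (i := i + 1) hi) hl.le
  have h3 : ∫ t in (m.x i)..x, |e t| ≤ ∫ t in (m.x i)..(m.x (i + 1)), |e t| :=
    intervalIntegral.integral_mono_interval le_rfl hx.1.le hx.2.le
      (Eventually.of_forall fun _ => abs_nonneg _)
      (intervalIntegrable_sub hE.integrable (m.x_mem hi.le) (m.x_mem (i := i + 1) hi)).abs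
  rw [← m.integral_cell hi] at h2 h3
  -- The interpolant moves monotonically between the nodal values of `E`, so it deviates from the
  -- left one by no more than their difference. `E` and `v` each contribute one `∫ |e|`.
  have h4 : |v x - E (m.x i)| ≤ |E (m.x (i + 1)) - E (m.x i)| := by
    have e1 := hv.affine i hi x (Set.Ioo_subset_Icc_self hx)
    have e2 := hv.affine i hi (m.x (i + 1)) ⟨hl.le, le_rfl⟩
    rw [hn i hi.le] at e1 e2
    rw [hn (i + 1) hi] at e2
    rw [e1, e2, add_sub_cancel_left, add_sub_cancel_left, abs_mul, abs_mul]
    refine mul_le_mul_of_nonneg_left ?_ (abs_nonneg _)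
    rw [abs_of_pos (sub_pos.2 hx.1), abs_of_pos (sub_pos.2 hl)]
    linarith [hx.2]
  calc |E x - v x| = |(E x - E (m.x i)) - (v x - E (m.x i))| := by congr 1; ring
    _ ≤ |E x - E (m.x i)| + |v x - E (m.x i)| := abs_sub _ _
    _ ≤ _ := by linarith

/-- A posteriori error estimate in the energy norm. -/
lemma error_estimate {a a' b b' c f u u' uh : ℝ → ℝ} {a₀ : ℝ}
    (hcoef : IsElliptic a a' b b' c a₀) (hf : MemLp f 2 muOmega)
    (hu : IsWeakSol a b c f u u') (hs : m.IsFESol a b c f uh) :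
    a₀ * √(∫ x in Omega, |u' x - deriv uh x| ^ 2) ≤ 2 * √(∑ i ∈ Finset.range N,
      m.h i ^ 3 * m.avg (residual a' b c f uh (deriv uh)) i ^ 2) := by
  obtain ⟨s, hPL⟩ := m.isPL_of_mem hs.mem
  obtain ⟨U, hU, hU0, hU1, huU⟩ := hu.mem.exists_isPrimitive
  have hE := hU.sub hPL.isPrimitive
  have hu'2 := hu.mem.memH1.memLp_deriv
  have huh'2 := hPL.memLp_deriv 2
  have he2 : MemLp (fun x => u' x - deriv uh x) 2 muOmega := hu'2.sub huh'2
  have hE0 : U 0 - uh 0 = 0 := by rw [hU0, hPL.zero, sub_zero]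
  have hE1 : U 1 - uh 1 = 0 := by rw [hU1, hPL.one, sub_zero]
  obtain ⟨v, hv, hvn⟩ := m.exists_interpolant (E := fun x => U x - uh x) hE0 hE1
  obtain ⟨σ, hvPL⟩ := m.isPL_of_mem hv
  have hW := hE.sub hvPL.isPrimitive
  have hv'2 := hvPL.memLp_deriv 2
  have hw2 : MemLp (fun x => u' x - deriv uh x - deriv v x) 2 muOmega := he2.sub hv'2
  have hWn : ∀ j ≤ N, U (m.x j) - uh (m.x j) - v (m.x j) = 0 := fun j hj => by
    rw [hvn j hj, sub_self]
  have hW0 : U 0 - uh 0 - v 0 = 0 := by rw [hE0, hvPL.zero, sub_zero]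
  have hW1 : U 1 - uh 1 - v 1 = 0 := by rw [hE1, hvPL.one, sub_zero]
  have hA := hcoef.memA.memLp
  have hB := hcoef.memB.memLp
  have hC := hcoef.memC
  have hcoer := hcoef.coercive hE hE0 hE1 he2
  have hWH := hW.memH10 hW0 hW1 hw2
  have q1 : bform a b c (fun x => U x - uh x) (fun x => u' x - deriv uh x)
      (fun x => U x - uh x - v x) (fun x => u' x - deriv uh x - deriv v x) =
      bform a b c (fun x => U x - uh x) (fun x => u' x - deriv uh x)
        (fun x => U x - uh x) (fun x => u' x - deriv uh x) -
      bform a b c (fun x => U x - uh x) (fun x => u' x - deriv uh x) v (deriv v) :=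
    bform_sub_right hA hB hC (hE.memLp 2) he2 (hE.memLp 2) he2
      (hvPL.isPrimitive.memLp 2) hv'2
  -- Galerkin orthogonality: the interpolant `v` is an admissible test function in both problems.
  have q2 : bform a b c (fun x => U x - uh x) (fun x => u' x - deriv uh x) v (deriv v) = 0 := by
    rw [bform_sub_left hA hB hC (hU.memLp 2) hu'2 (hPL.isPrimitive.memLp 2) huh'2
      (hvPL.isPrimitive.memLp 2) hv'2, ← bform_congr_left huU, hu.eqn v _ hvPL.memH10,
      hs.eqn v hv, sub_self]
  have q3 := bform_sub_left hA hB hC (hU.memLp 2) hu'2 (hPL.isPrimitive.memLp 2) huh'2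
    (hW.memLp 2) hw2
  rw [← bform_congr_left huU, hu.eqn _ _ hWH,
    m.load_sub_bform hcoef hf hPL hW hWn hw2] at q3
  have q4 := m.integral_mul_le_sqrt
    (memLp_residual hcoef.memA.memLp_deriv hB hC hf (hPL.isPrimitive.memLp 2) huh'2) he2
    (hW.memLp 2) (fun i hi x hx => m.abs_sub_interpolant_le hE hvPL hvn hi hx)
  rw [q2, sub_zero] at q1
  rw [← q1, q3] at hcoer
  have q5 := hcoer.trans q4
  have hn : 0 ≤ ∫ x in Omega, |u' x - deriv uh x| ^ 2 := integral_nonneg fun _ => by positivity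
  rcases hn.eq_or_lt with h | h
  · rw [← h, Real.sqrt_zero, mul_zero]; positivity
  · nth_rewrite 1 [← Real.mul_self_sqrt hn] at q5
    rw [← mul_assoc] at q5
    exact le_of_mul_le_mul_right q5 (Real.sqrt_pos.2 h)

end Mesh

/-! ### Cell averages with exponent 2/3 -/

lemma integrable_rpow_two_thirds {μ : Measure ℝ} [IsFiniteMeasure μ] {w : ℝ → ℝ}
    (hw : MemLp w 2 μ) : Integrable (fun x => |w x| ^ (2 / 3 : ℝ)) μ := by
  refine ((integrable_abs_sq hw).add (integrable_const (1 : ℝ))).mono'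
    (hw.aestronglyMeasurable.aemeasurable.abs.pow_const _).aestronglyMeasurable ?_
  refine Eventually.of_forall fun x => ?_
  rw [Real.norm_of_nonneg (by positivity)]
  simp only [Pi.add_apply]
  rcases le_total |w x| 1 with h | h
  · have := Real.rpow_le_one (abs_nonneg (w x)) h (z := 2 / 3) (by norm_num)
    nlinarith [sq_nonneg |w x|]
  · have := Real.rpow_le_rpow_of_exponent_le h (y := 2 / 3) (z := 2) (by norm_num)
    rw [Real.rpow_two] at this
    linarith

lemma rpow_two_thirds_eq {x : ℝ} (hx : 0 ≤ x) : x ^ (2 / 3 : ℝ) = (x ^ 2) ^ (1 / 3 : ℝ) := by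
  rw [← Real.rpow_natCast, ← Real.rpow_mul hx]
  norm_num

lemma rpow_two_thirds_cube {x : ℝ} (hx : 0 ≤ x) : (x ^ (2 / 3 : ℝ)) ^ 3 = x ^ 2 := by
  rw [← Real.rpow_natCast, ← Real.rpow_mul hx, ← Real.rpow_natCast]
  norm_num

lemma add_rpow_two_thirds_le {x y : ℝ} (hx : 0 ≤ x) (hy : 0 ≤ y) :
    (x + y) ^ (2 / 3 : ℝ) ≤ x ^ (2 / 3 : ℝ) + y ^ (2 / 3 : ℝ) :=
  Real.rpow_add_le_add_rpow hx hy (by norm_num) (by norm_num)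

namespace Mesh

variable {N : ℕ} (m : Mesh N)

/-- The sum `Σ_i h_i ⟨w⟩_i^{2/3}`. -/
noncomputable def avgSum (w : ℝ → ℝ) : ℝ := ∑ i ∈ Finset.range N, m.h i * m.avg w i ^ (2 / 3 : ℝ)

lemma h_nonneg_of_mem {i : ℕ} (hi : i ∈ Finset.range N) : 0 ≤ m.h i :=
  (m.h_pos (Finset.mem_range.1 hi)).le

lemma avgSum_nonneg (w : ℝ → ℝ) : 0 ≤ m.avgSum w :=
  Finset.sum_nonneg fun _ hi => mul_nonneg (m.h_nonneg_of_mem hi)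
    (Real.rpow_nonneg (m.avg_nonneg w _) _)

lemma alpha_eq (w : ℝ → ℝ) : m.alpha w = m.avgSum w ^ 3 := rfl

lemma sqrt_alpha (w : ℝ → ℝ) : √(m.alpha w) = m.avgSum w ^ (3 / 2 : ℝ) := by
  rw [alpha_eq, Real.sqrt_eq_rpow, ← Real.rpow_natCast, ← Real.rpow_mul (m.avgSum_nonneg w)]
  norm_num

lemma avg_add_le {v w : ℝ → ℝ} (hv : MemLp v 2 muOmega) (hw : MemLp w 2 muOmega) {i : ℕ}
    (hi : i < N) : m.avg (fun x => v x + w x) i ≤ m.avg v i + m.avg w i := by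
  refine le_of_mul_le_mul_left ?_ (Real.sqrt_pos.2 (m.h_pos hi))
  rw [mul_add, m.sqrt_h_mul_avg hi, m.sqrt_h_mul_avg hi, m.sqrt_h_mul_avg hi]
  exact sqrt_integral_sq_add_le (m.memLp_cell hi hv) (m.memLp_cell hi hw)

/-- Minkowski on each cell, then subadditivity of `t^(2/3)`. This is the reason for working with
`avgSum` in place of its power `√α`. -/
lemma avgSum_add_le {v w : ℝ → ℝ} (hv : MemLp v 2 muOmega) (hw : MemLp w 2 muOmega) :
    m.avgSum (fun x => v x + w x) ≤ m.avgSum v + m.avgSum w := by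
  rw [avgSum, avgSum, avgSum, ← Finset.sum_add_distrib]
  refine Finset.sum_le_sum fun i hi => ?_
  rw [← mul_add]
  refine mul_le_mul_of_nonneg_left ?_ (m.h_nonneg_of_mem hi)
  refine (Real.rpow_le_rpow (m.avg_nonneg _ _)
    (m.avg_add_le hv hw (Finset.mem_range.1 hi)) (by norm_num)).trans ?_
  exact add_rpow_two_thirds_le (m.avg_nonneg _ _) (m.avg_nonneg _ _)

lemma avg_congr {v w : ℝ → ℝ} (h : v =ᵐ[muOmega] w) {i : ℕ} (hi : i < N) :
    m.avg v i = m.avg w i := by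
  unfold avg
  congr 2
  refine integral_congr_ae ?_
  filter_upwards [ae_restrict_of_ae_restrict_of_subset (m.Ioo_subset hi) h] with x hx
  rw [hx]

lemma avgSum_congr {v w : ℝ → ℝ} (h : v =ᵐ[muOmega] w) : m.avgSum v = m.avgSum w :=
  Finset.sum_congr rfl fun i hi => by rw [m.avg_congr h (Finset.mem_range.1 hi)]

/-- Jensen's inequality over the cells. -/
lemma avgSum_le {w : ℝ → ℝ} (hw : MemLp w 2 muOmega) :
    m.avgSum w ≤ √(∫ x in Omega, |w x| ^ 2) ^ (2 / 3 : ℝ) := by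
  have h := Real.arith_mean_le_rpow_mean (Finset.range N) m.h
    (fun i => m.avg w i ^ (2 / 3 : ℝ)) (fun i hi => m.h_nonneg_of_mem hi) m.sum_h
    (fun i _ => Real.rpow_nonneg (m.avg_nonneg w i) _) (p := 3) (by norm_num)
  refine h.trans (le_of_eq ?_)
  rw [rpow_two_thirds_eq (Real.sqrt_nonneg _), Real.sq_sqrt (integral_nonneg fun _ => by positivity),
    ← m.sum_integral (integrable_abs_sq hw)]
  congr 1
  refine Finset.sum_congr rfl fun i hi => ?_
  rw [← m.h_mul_avg_sq (Finset.mem_range.1 hi), ← rpow_two_thirds_cube (m.avg_nonneg w i)]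
  norm_cast

/-- Jensen's inequality within each cell. -/
lemma integral_rpow_le_avgSum {w : ℝ → ℝ} (hw : MemLp w 2 muOmega) :
    ∫ x in Omega, |w x| ^ (2 / 3 : ℝ) ≤ m.avgSum w := by
  rw [← m.sum_integral (integrable_rpow_two_thirds hw)]
  refine Finset.sum_le_sum fun i hi => ?_
  rw [Finset.mem_range] at hi
  have hp := m.h_pos hi
  have hw' := m.memLp_cell hi hw
  have hr := m.measureReal_cell hi
  have : NeZero (volume.restrict (Set.Ioo (m.x i) (m.x (i + 1)))) := by
    refine ⟨fun h => ?_⟩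
    rw [h] at hr
    simp at hr
    exact hp.ne hr
  have hc : ConcaveOn ℝ (Set.Ici 0) fun x : ℝ => x ^ (1 / 3 : ℝ) :=
    Real.concaveOn_rpow (by norm_num) (by norm_num)
  have e : ∀ x, (|w x| ^ 2) ^ (1 / 3 : ℝ) = |w x| ^ (2 / 3 : ℝ) := fun x =>
    (rpow_two_thirds_eq (abs_nonneg _)).symm
  have h := hc.le_map_average (μ := volume.restrict (Set.Ioo (m.x i) (m.x (i + 1))))
    (f := fun x => |w x| ^ 2)
    (continuousOn_id.rpow_const fun _ _ => Or.inr (by norm_num)) isClosed_Ici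
    (Eventually.of_forall fun x => by simp only [Set.mem_Ici]; positivity)
    (integrable_abs_sq hw')
    ((integrable_rpow_two_thirds hw').congr (Eventually.of_forall fun x => (e x).symm))
  simp only [e] at h
  rw [average_eq, average_eq, hr, smul_eq_mul, smul_eq_mul] at h
  have e2 : ((m.h i)⁻¹ * ∫ x in Set.Ioo (m.x i) (m.x (i + 1)), |w x| ^ 2) = m.avg w i ^ 2 := by
    rw [← m.h_mul_avg_sq hi, inv_mul_cancel_left₀ hp.ne']
  rw [e2, ← rpow_two_thirds_eq (m.avg_nonneg w i), inv_mul_le_iff₀ hp] at h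
  exact h

lemma avg_le_of_oscillation {G : ℝ → ℝ} (hG : MemLp G 2 muOmega) {d : ℝ} (hd : 0 ≤ d) {i : ℕ}
    (hi : i < N) {x : ℝ} (hosc : ∀ y ∈ Set.Ioo (m.x i) (m.x (i + 1)), |G y - G x| ≤ d) :
    m.avg G i ≤ |G x| + d := by
  refine le_of_sq_le_sq ?_ (by positivity)
  refine le_of_mul_le_mul_left ?_ (m.h_pos hi)
  rw [m.h_mul_avg_sq hi]
  have h1 : ∫ y in Set.Ioo (m.x i) (m.x (i + 1)), |G y| ^ 2 ≤
      ∫ _ in Set.Ioo (m.x i) (m.x (i + 1)), (|G x| + d) ^ 2 := by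
    refine setIntegral_mono_on (integrable_abs_sq (m.memLp_cell hi hG)) (integrable_const _)
      measurableSet_Ioo fun y hy => ?_
    have := abs_sub_abs_le_abs_sub (G y) (G x)
    have := hosc y hy
    gcongr
    linarith
  rwa [integral_const, m.measureReal_cell hi, smul_eq_mul] at h1

/-- A converse to Jensen: `⟨G⟩_i ≤ |G x| + d i` at every point `x` of the cell; take the power 2/3
and integrate in `x`. -/
lemma avgSum_le_of_oscillation {G : ℝ → ℝ} (hG : MemLp G 2 muOmega) {d : ℕ → ℝ}
    (hd : ∀ i < N, 0 ≤ d i)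
    (hosc : ∀ i < N, ∀ x ∈ Set.Ioo (m.x i) (m.x (i + 1)), ∀ y ∈ Set.Ioo (m.x i) (m.x (i + 1)),
      |G y - G x| ≤ d i) :
    m.avgSum G ≤ (∫ x in Omega, |G x| ^ (2 / 3 : ℝ)) +
      ∑ i ∈ Finset.range N, m.h i * d i ^ (2 / 3 : ℝ) := by
  rw [← m.sum_integral (integrable_rpow_two_thirds hG), ← Finset.sum_add_distrib]
  refine Finset.sum_le_sum fun i hi => ?_
  rw [Finset.mem_range] at hi
  have hG' := integrable_rpow_two_thirds (m.memLp_cell hi hG)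
  have h1 : ∫ _ in Set.Ioo (m.x i) (m.x (i + 1)), m.avg G i ^ (2 / 3 : ℝ) ≤
      ∫ x in Set.Ioo (m.x i) (m.x (i + 1)), (|G x| ^ (2 / 3 : ℝ) + d i ^ (2 / 3 : ℝ)) := by
    refine setIntegral_mono_on (integrable_const _) (hG'.add (integrable_const _))
      measurableSet_Ioo fun x hx => ?_
    refine (Real.rpow_le_rpow (m.avg_nonneg G i)
      (m.avg_le_of_oscillation hG (hd i hi) hi (hosc i hi x hx)) (by norm_num)).trans ?_
    exact add_rpow_two_thirds_le (abs_nonneg _) (hd i hi)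
  rw [integral_add hG' (integrable_const _), integral_const, integral_const,
    m.measureReal_cell hi, smul_eq_mul, smul_eq_mul] at h1
  exact h1

/-- The weights `h i` sum to one, so the power mean inequality with exponent 3/2 moves the power 2/3
outside. -/
lemma sum_h_mul_rpow_le {d : ℕ → ℝ} (hd : ∀ i < N, 0 ≤ d i) {η : ℝ}
    (hη : ∀ i < N, m.h i ≤ η) :
    ∑ i ∈ Finset.range N, m.h i * d i ^ (2 / 3 : ℝ) ≤
      (η * ∑ i ∈ Finset.range N, d i) ^ (2 / 3 : ℝ) := by
  have hd' : ∀ i ∈ Finset.range N, 0 ≤ d i := fun i hi => hd i (Finset.mem_range.1 hi)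
  have h := Real.arith_mean_le_rpow_mean (Finset.range N) m.h
    (fun i => d i ^ (2 / 3 : ℝ)) (fun i hi => m.h_nonneg_of_mem hi) m.sum_h
    (fun i hi => Real.rpow_nonneg (hd' i hi) _) (p := 3 / 2) (by norm_num)
  refine h.trans ?_
  have e : ∑ i ∈ Finset.range N, m.h i * (d i ^ (2 / 3 : ℝ)) ^ (3 / 2 : ℝ) =
      ∑ i ∈ Finset.range N, m.h i * d i := by
    refine Finset.sum_congr rfl fun i hi => ?_
    rw [← Real.rpow_mul (hd' i hi)]
    norm_num
  rw [e, show (1 / (3 / 2) : ℝ) = 2 / 3 by norm_num, Finset.mul_sum]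
  refine Real.rpow_le_rpow (Finset.sum_nonneg fun i hi =>
    mul_nonneg (m.h_nonneg_of_mem hi) (hd' i hi)) ?_ (by norm_num)
  exact Finset.sum_le_sum fun i hi =>
    mul_le_mul_of_nonneg_right (hη i (Finset.mem_range.1 hi)) (hd' i hi)

/-- Bound of the averages of a function with integrable derivative. -/
lemma avgSum_le_of_isPrimitive {G g : ℝ → ℝ} (hG : IsPrimitive G g) {η : ℝ}
    (hη : ∀ i < N, m.h i ≤ η) :
    m.avgSum G ≤ (∫ x in Omega, |G x| ^ (2 / 3 : ℝ)) +
      (η * ∫ x in Omega, |g x|) ^ (2 / 3 : ℝ) := by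
  have hg := integrable_iff_intervalIntegrable.2 hG.integrable
  -- The oscillation on a cell is at most the local integral of `|g|`, and these add up to the `L¹`
  -- norm.
  set d : ℕ → ℝ := fun i => ∫ x in Set.Ioo (m.x i) (m.x (i + 1)), |g x| with hd
  have hd0 : ∀ i < N, 0 ≤ d i := fun i _ => integral_nonneg fun _ => abs_nonneg _
  have key : ∀ i < N, ∀ x ∈ Set.Ioo (m.x i) (m.x (i + 1)), ∀ y ∈ Set.Ioo (m.x i) (m.x (i + 1)),
      x ≤ y → |G y - G x| ≤ d i := by
    intro i hi x hx y hy hxy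
    have hx' := m.Icc_subset hi (Set.Ioo_subset_Icc_self hx)
    have hy' := m.Icc_subset hi (Set.Ioo_subset_Icc_self hy)
    refine (hG.abs_sub_le hx' hy' hxy).trans ?_
    simp only [hd]
    rw [m.integral_cell hi]
    exact intervalIntegral.integral_mono_interval hx.1.le hxy hy.2.le
      (Eventually.of_forall fun _ => abs_nonneg _)
      (intervalIntegrable_sub hG.integrable (m.x_mem hi.le) (m.x_mem (i := i + 1) hi)).abs
  refine (m.avgSum_le_of_oscillation (hG.memLp 2) hd0 fun i hi x hx y hy => ?_).trans ?_
  · rcases le_total x y with h | h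
    · exact key i hi x hx y hy h
    · rw [abs_sub_comm]
      exact key i hi y hy x hx h
  · rw [← m.sum_integral hg.abs]
    exact add_le_add le_rfl (m.sum_h_mul_rpow_le hd0 hη)

/-! ### Consequences of equidistribution -/

section Equidistribution

variable {m} {w : ℝ → ℝ}

lemma avg_eq_zero_of_alpha_eq_zero (h : m.alpha w = 0) {i : ℕ} (hi : i < N) :
    m.avg w i = 0 := by
  rw [alpha_eq, pow_eq_zero_iff three_ne_zero, avgSum, Finset.sum_eq_zero_iff_of_nonneg
    (fun i hi => mul_nonneg (m.h_nonneg_of_mem hi) (Real.rpow_nonneg (m.avg_nonneg w _) _))] at h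
  have h1 := h i (Finset.mem_range.2 hi)
  rw [mul_eq_zero, or_iff_right (m.h_pos hi).ne'] at h1
  exact ((Real.rpow_eq_zero (m.avg_nonneg w i) (by norm_num)).1 h1)

lemma alpha_nonneg (w : ℝ → ℝ) : 0 ≤ m.alpha w := by
  rw [alpha_eq]
  exact pow_nonneg (m.avgSum_nonneg w) 3

lemma one_le_rho (w : ℝ → ℝ) (i : ℕ) : 1 ≤ m.rho w i := by
  refine Real.one_le_rpow ?_ (by norm_num)
  have := div_nonneg (sq_nonneg (m.avg w i)) (alpha_nonneg (m := m) w)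
  linarith

/-- `ρ³ = 1 + ⟨w⟩² / α`. If `α = 0`, the average vanishes too. -/
lemma avg_sq_le {i : ℕ} (hi : i < N) : m.avg w i ^ 2 ≤ m.alpha w * m.rho w i ^ 3 := by
  have h0 := div_nonneg (sq_nonneg (m.avg w i)) (alpha_nonneg (m := m) w)
  rw [rho, ← Real.rpow_natCast (_ ^ _), ← Real.rpow_mul (by linarith)]
  norm_num
  rcases (alpha_nonneg (m := m) w).eq_or_lt with h | h
  · rw [avg_eq_zero_of_alpha_eq_zero h.symm hi]
    simp [← h]
  · rw [mul_add, mul_div_cancel₀ _ h.ne']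
    linarith

/-- `(1 + t)^(1/3) ≤ 1 + t^(1/3)`, and `α^(1/3)` is exactly `avgSum`; the two terms therefore sum to
at most `1 + 1`. -/
lemma sigma_le_two (w : ℝ → ℝ) : m.sigma w ≤ 2 := by
  have h1 : ∀ i ∈ Finset.range N, m.rho w i * m.h i ≤
      m.h i + m.h i * m.avg w i ^ (2 / 3 : ℝ) / m.avgSum w := by
    intro i hi
    have h0 := div_nonneg (sq_nonneg (m.avg w i)) (alpha_nonneg (m := m) w)
    have h2 : m.rho w i ≤ 1 + m.avg w i ^ (2 / 3 : ℝ) / m.avgSum w := by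
      refine (Real.rpow_add_le_add_rpow zero_le_one h0 (by norm_num) (by norm_num)).trans ?_
      rw [Real.one_rpow, Real.div_rpow (sq_nonneg _) (alpha_nonneg w),
        ← rpow_two_thirds_eq (m.avg_nonneg w i), alpha_eq, ← Real.rpow_natCast,
        ← Real.rpow_mul (m.avgSum_nonneg w)]
      norm_num
    have := mul_le_mul_of_nonneg_right h2 (m.h_nonneg_of_mem hi)
    refine this.trans (le_of_eq ?_)
    ring
  refine (Finset.sum_le_sum h1).trans ?_
  rw [Finset.sum_add_distrib, m.sum_h, ← Finset.sum_div]
  have : m.avgSum w / m.avgSum w ≤ 1 := div_self_le_one _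
  have h3 : (∑ i ∈ Finset.range N, m.h i * m.avg w i ^ (2 / 3 : ℝ)) / m.avgSum w =
    m.avgSum w / m.avgSum w := rfl
  linarith

lemma Equidistributes.rho_mul_h_le (he : m.Equidistributes w) {i : ℕ} (hi : i < N) :
    m.rho w i * m.h i ≤ 2 / N := by
  rw [he i hi]
  exact div_le_div_of_nonneg_right (sigma_le_two w) (Nat.cast_nonneg N)

lemma Equidistributes.h_le (he : m.Equidistributes w) {i : ℕ} (hi : i < N) :
    m.h i ≤ 2 / N :=
  (le_mul_of_one_le_left (m.h_pos hi).le (one_le_rho w i)).trans (he.rho_mul_h_le hi)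

/-- Each term is at most `α (ρ h)³ ≤ α (2/N)³`, and there are `N` of them. -/
lemma Equidistributes.sum_le (he : m.Equidistributes w) :
    ∑ i ∈ Finset.range N, m.h i ^ 3 * m.avg w i ^ 2 ≤ m.alpha w * 8 / (N : ℝ) ^ 2 := by
  have hN : (0 : ℝ) < N := Nat.cast_pos.2 m.pos
  have h1 : ∀ i ∈ Finset.range N, m.h i ^ 3 * m.avg w i ^ 2 ≤ m.alpha w * (2 / N) ^ 3 := by
    intro i hi
    have hh := m.h_nonneg_of_mem hi
    rw [Finset.mem_range] at hi
    have hρ := zero_le_one.trans (one_le_rho (m := m) w i)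
    calc m.h i ^ 3 * m.avg w i ^ 2 ≤ m.h i ^ 3 * (m.alpha w * m.rho w i ^ 3) :=
          mul_le_mul_of_nonneg_left (avg_sq_le hi) (pow_nonneg hh 3)
      _ = m.alpha w * (m.rho w i * m.h i) ^ 3 := by ring
      _ ≤ _ := mul_le_mul_of_nonneg_left
          (pow_le_pow_left₀ (mul_nonneg hρ hh) (he.rho_mul_h_le hi) 3) (alpha_nonneg w)
  refine (Finset.sum_le_sum h1).trans (le_of_eq ?_)
  rw [Finset.sum_const, Finset.card_range, nsmul_eq_mul]
  field_simp
  ring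

end Equidistribution

end Mesh

/-! ### Comparison of the exact and the discrete residual -/

lemma exists_ae_bound_of_memLp_top {μ : Measure ℝ} {f : ℝ → ℝ} (hf : MemLp f ⊤ μ) :
    ∃ M : ℝ, 0 ≤ M ∧ ∀ᵐ x ∂μ, |f x| ≤ M := by
  have hfin := hf.eLpNorm_ne_top
  rw [eLpNorm_exponent_top] at hfin
  refine ⟨(eLpNormEssSup f μ).toReal, ENNReal.toReal_nonneg, ?_⟩
  filter_upwards [ae_le_eLpNormEssSup (f := f) (μ := μ)] with x hx
  simpa using ENNReal.toReal_mono hfin hx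

lemma IsPrimitive.abs_le_sqrt {F f : ℝ → ℝ} (h : IsPrimitive F f) (h0 : F 0 = 0)
    (hf : MemLp f 2 muOmega) {x : ℝ} (hx : x ∈ Set.Icc (0 : ℝ) 1) :
    |F x| ≤ √(∫ x in Omega, |f x| ^ 2) := by
  have := ENNReal.toReal_mono hf.eLpNorm_ne_top (h.enorm_le h0 hx)
  rwa [toReal_eLpNorm_two hf, toReal_enorm, Real.norm_eq_abs] at this

/-- Residuals depend Lipschitz continuously on the functions they are taken of. -/
lemma sqrt_integral_residual_sub_le {a' b c f u u' v v' U : ℝ → ℝ} {M : ℝ} (hM : 0 ≤ M)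
    (hab : ∀ᵐ x ∂muOmega, |a' x - b x| ≤ M) (hc : ∀ᵐ x ∂muOmega, |c x| ≤ M)
    (huU : u =ᵐ[muOmega] U) (hE : IsPrimitive (fun x => U x - v x) (fun x => u' x - v' x))
    (hE0 : U 0 - v 0 = 0) (he : MemLp (fun x => u' x - v' x) 2 muOmega)
    (hr : MemLp (fun x => residual a' b c f u u' x - residual a' b c f v v' x) 2 muOmega) :
    √(∫ x in Omega, |residual a' b c f u u' x - residual a' b c f v v' x| ^ 2) ≤
      2 * M * √(∫ x in Omega, |u' x - v' x| ^ 2) := by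
  set D := √(∫ x in Omega, |u' x - v' x| ^ 2) with hD
  have hD0 : 0 ≤ D := Real.sqrt_nonneg _
  have hDsq : D ^ 2 = ∫ x in Omega, |u' x - v' x| ^ 2 :=
    Real.sq_sqrt (integral_nonneg fun _ => by positivity)
  refine Real.sqrt_le_iff.2 ⟨by positivity, ?_⟩
  -- Pointwise `(M |e| + M D)² ≤ 2 M² |e|² + 2 M² D²` with `e = u' - v'`. Over a domain of measure
  -- one this integrates to `4 M² D²`, whence the constant `2 M`.
  have h1 : ∫ x in Omega, |residual a' b c f u u' x - residual a' b c f v v' x| ^ 2 ≤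
      ∫ x, (2 * M ^ 2 * |u' x - v' x| ^ 2 + 2 * M ^ 2 * D ^ 2) ∂muOmega := by
    refine integral_mono_ae (integrable_abs_sq hr)
      (((integrable_abs_sq he).const_mul _).add (integrable_const _)) ?_
    filter_upwards [hab, hc, huU, ae_muOmega_mem] with x h1 h2 h3 h4
    have h5 := hE.abs_le_sqrt hE0 he h4
    rw [← hD] at h5
    have e : residual a' b c f u u' x - residual a' b c f v v' x =
        (a' x - b x) * (u' x - v' x) - c x * (U x - v x) := by
      rw [residual, residual, h3]; ring
    have h6 : |residual a' b c f u u' x - residual a' b c f v v' x| ≤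
        M * |u' x - v' x| + M * D := by
      rw [e]
      refine (abs_sub _ _).trans ?_
      rw [abs_mul, abs_mul]
      gcongr
    calc |residual a' b c f u u' x - residual a' b c f v v' x| ^ 2
        ≤ (M * |u' x - v' x| + M * D) ^ 2 := by gcongr
      _ ≤ _ := by nlinarith [sq_nonneg (M * |u' x - v' x| - M * D)]
  refine h1.trans (le_of_eq ?_)
  rw [integral_add ((integrable_abs_sq he).const_mul _) (integrable_const _), integral_const_mul,
    integral_const]
  have : ∫ x, |u' x - v' x| ^ 2 ∂muOmega = D ^ 2 := hDsq.symm
  rw [this]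
  simp
  ring

lemma normLp_two (v : ℝ → ℝ) : normLp 2 v = √(∫ x in Omega, |v x| ^ 2) := by
  simp [normLp, Real.sqrt_eq_rpow]

lemma normLp_one (v : ℝ → ℝ) : normLp 1 v = ∫ x in Omega, |v x| := by
  simp [normLp]

lemma normLp_two_thirds (v : ℝ → ℝ) :
    normLp (2 / 3) v = (∫ x in Omega, |v x| ^ (2 / 3 : ℝ)) ^ (3 / 2 : ℝ) := by
  norm_num [normLp]

namespace Mesh

/-- The averages of an `L²` function converge on refined meshes. -/
lemma exists_avgSum_le_add {r : ℝ → ℝ} (hr : MemLp r 2 muOmega) {δ : ℝ} (hδ : 0 < δ) (C : ℝ) :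
    ∃ N₀ : ℕ, ∀ N ≥ N₀, ∀ m : Mesh N, (∀ i < N, m.h i ≤ C / N) →
      m.avgSum r ≤ (∫ x in Omega, |r x| ^ (2 / 3 : ℝ)) + δ := by
  have hpow : ∀ t : ℝ, 0 ≤ t → (t ^ (3 / 2 : ℝ)) ^ (2 / 3 : ℝ) = t := fun t ht => by
    rw [← Real.rpow_mul ht]; norm_num
  -- The power 3/2 undoes 2/3. The approximation error of `g` enters twice, with `δ / 4` each, in
  -- `avgSum` and in the integral; the oscillation of `g` takes the remaining `δ / 2`.
  have hη : 0 < (δ / 4) ^ (3 / 2 : ℝ) := by positivity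
  have hω : 0 < (δ / 2) ^ (3 / 2 : ℝ) := by positivity
  obtain ⟨g, -, hg, hgc, hg2⟩ := hr.exists_hasCompactSupport_eLpNorm_sub_le
    (ENNReal.ofNat_ne_top) (ENNReal.ofReal_pos.2 hη).ne'
  have hrg : MemLp (fun x => r x - g x) 2 muOmega := hr.sub hg2
  have hgr : MemLp (fun x => g x - r x) 2 muOmega := hg2.sub hr
  have hl2 : √(∫ x in Omega, |r x - g x| ^ 2) ≤ (δ / 4) ^ (3 / 2 : ℝ) := by
    have := ENNReal.toReal_mono ENNReal.ofReal_ne_top hg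
    rw [ENNReal.toReal_ofReal hη.le] at this
    exact (toReal_eLpNorm_two hrg).symm.trans_le this
  obtain ⟨τ, hτ, hunif⟩ := Metric.uniformContinuousOn_iff.1
    (isCompact_Icc.uniformContinuousOn_of_continuous
      (hgc.continuousOn (s := Set.Icc (0 : ℝ) 1))) _ hω
  have hlim := (tendsto_const_div_atTop_nhds_zero_nat C).eventually (gt_mem_nhds hτ)
  obtain ⟨N₀, hN₀⟩ := eventually_atTop.1 hlim
  refine ⟨N₀, fun N hN m hm => ?_⟩
  have hosc := m.avgSum_le_of_oscillation hg2 (d := fun _ => (δ / 2) ^ (3 / 2 : ℝ))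
    (fun _ _ => hω.le) (by
      intro i hi x hx y hy
      refine (hunif y (m.Icc_subset hi (Set.Ioo_subset_Icc_self hy)) x
        (m.Icc_subset hi (Set.Ioo_subset_Icc_self hx)) ?_).le
      refine lt_of_le_of_lt ?_ ((hm i hi).trans_lt (hN₀ N hN))
      rw [Real.dist_eq, abs_le, h]
      constructor <;> linarith [hx.1, hx.2, hy.1, hy.2])
  rw [← Finset.sum_mul, m.sum_h, one_mul, hpow _ (by positivity)] at hosc
  have h1 : m.avgSum (fun x => r x - g x) ≤ δ / 4 := by
    refine (m.avgSum_le hrg).trans ?_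
    refine (Real.rpow_le_rpow (Real.sqrt_nonneg _) hl2 (by norm_num)).trans ?_
    rw [hpow _ (by positivity)]
  have h2 : m.avgSum r ≤ m.avgSum g + m.avgSum (fun x => r x - g x) := by
    simpa using m.avgSum_add_le hg2 hrg
  have h3 : ∫ x in Omega, |g x| ^ (2 / 3 : ℝ) ≤
      (∫ x in Omega, |r x| ^ (2 / 3 : ℝ)) + ∫ x in Omega, |r x - g x| ^ (2 / 3 : ℝ) := by
    have i1 := integrable_rpow_two_thirds hr
    have i2 := integrable_rpow_two_thirds hrg
    refine le_of_le_of_eq ?_ (integral_add (μ := muOmega) i1 i2)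
    refine integral_mono (μ := muOmega) (integrable_rpow_two_thirds hg2) (i1.add i2) fun x => ?_
    refine le_trans (Real.rpow_le_rpow (abs_nonneg _) ?_ (by norm_num))
      (add_rpow_two_thirds_le (abs_nonneg (r x)) (abs_nonneg (r x - g x)))
    have := abs_sub (r x) (r x - g x)
    rwa [sub_sub_cancel] at this
  have h4 := m.integral_rpow_le_avgSum hrg
  linarith

end Mesh

/-- The energy error bound in terms of `α_h`. -/
lemma IsEquiFESol.error_le {a a' b b' c f u u' uh : ℝ → ℝ} {a₀ : ℝ} {N : ℕ} {m : Mesh N}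
    (hcoef : IsElliptic a a' b b' c a₀) (hf : MemLp f 2 muOmega)
    (hu : IsWeakSol a b c f u u') (hs : IsEquiFESol m a a' b c f uh) :
    √(∫ x in Omega, |u' x - deriv uh x| ^ 2) ≤
      6 / a₀ * √(m.alpha (residual a' b c f uh (deriv uh))) / N := by
  have hN : (0 : ℝ) < N := Nat.cast_pos.2 m.pos
  have h0 := hcoef.pos
  have h1 := m.error_estimate hcoef hf hu hs.sol
  have h2 := Real.sqrt_le_sqrt hs.equi.sum_le
  set α := m.alpha (residual a' b c f uh (deriv uh)) with hα
  have hα0 : 0 ≤ α := Mesh.alpha_nonneg _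
  -- `√8 ≤ 3`; with the factor 2 of the error estimate this gives the 6 in `6 / a₀`.
  have h3 : √(α * 8 / (N : ℝ) ^ 2) ≤ 3 * √α / N := by
    refine Real.sqrt_le_iff.2 ⟨by positivity, ?_⟩
    rw [div_pow, mul_pow, Real.sq_sqrt hα0]
    exact div_le_div_of_nonneg_right (by linarith) (by positivity)
  have h4 : a₀ * √(∫ x in Omega, |u' x - deriv uh x| ^ 2) ≤ 2 * (3 * √α / N) :=
    h1.trans (mul_le_mul_of_nonneg_left (h2.trans h3) zero_le_two)
  calc √(∫ x in Omega, |u' x - deriv uh x| ^ 2) ≤ 2 * (3 * √α / N) / a₀ := by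
        rw [le_div_iff₀ h0]; linarith
    _ = _ := by field_simp; ring

/-- Comparison of the averages of the exact and of the discrete residual. -/
lemma IsEquiFESol.avgSum_bounds {a a' b b' c f u u' uh : ℝ → ℝ} {a₀ M K : ℝ} {N : ℕ} {m : Mesh N}
    (hcoef : IsElliptic a a' b b' c a₀) (hM : 0 ≤ M)
    (hab : ∀ᵐ x ∂muOmega, |a' x - b x| ≤ M) (hc : ∀ᵐ x ∂muOmega, |c x| ≤ M)
    (hK : 2 * M * (6 / a₀) ≤ K) (hf : MemLp f 2 muOmega)
    (hu : IsWeakSol a b c f u u') (hs : IsEquiFESol m a a' b c f uh) :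
    m.avgSum (residual a' b c f uh (deriv uh)) ≤ m.avgSum (residual a' b c f u u') +
        (K / N) ^ (2 / 3 : ℝ) * m.avgSum (residual a' b c f uh (deriv uh)) ∧
      m.avgSum (residual a' b c f u u') ≤
        (1 + (K / N) ^ (2 / 3 : ℝ)) * m.avgSum (residual a' b c f uh (deriv uh)) := by
  have hN : (0 : ℝ) < N := Nat.cast_pos.2 m.pos
  obtain ⟨s, hPL⟩ := m.isPL_of_mem hs.sol.mem
  obtain ⟨U, hU, hU0, hU1, huU⟩ := hu.mem.exists_isPrimitive
  have hE := hU.sub hPL.isPrimitive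
  have hE0 : U 0 - uh 0 = 0 := by rw [hU0, hPL.zero, sub_zero]
  have he2 : MemLp (fun x => u' x - deriv uh x) 2 muOmega :=
    hu.mem.memH1.memLp_deriv.sub (hPL.memLp_deriv 2)
  have hr := memLp_residual hcoef.memA.memLp_deriv hcoef.memB.memLp hcoef.memC hf
    hu.mem.memH1.memLp hu.mem.memH1.memLp_deriv
  have hrh := memLp_residual hcoef.memA.memLp_deriv hcoef.memB.memLp hcoef.memC hf
    (hPL.isPrimitive.memLp 2) (hPL.memLp_deriv 2)
  have hd := sqrt_integral_residual_sub_le (f := f) hM hab hc huU hE hE0 he2 (hr.sub hrh)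
  have herr := hs.error_le hcoef hf hu
  set r := residual a' b c f u u'
  set rh := residual a' b c f uh (deriv uh)
  have h1 : √(∫ x in Omega, |r x - rh x| ^ 2) ≤ K / N * √(m.alpha rh) := by
    refine hd.trans ((mul_le_mul_of_nonneg_left herr (by positivity)).trans ?_)
    calc 2 * M * (6 / a₀ * √(m.alpha rh) / N) = 2 * M * (6 / a₀) / N * √(m.alpha rh) := by ring
      _ ≤ _ := by gcongr
  have hK0 : 0 ≤ K := le_trans (by have := hcoef.pos; positivity) hK
  have hA := m.avgSum_nonneg rh
  have h2 : √(∫ x in Omega, |r x - rh x| ^ 2) ^ (2 / 3 : ℝ) ≤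
      (K / N) ^ (2 / 3 : ℝ) * m.avgSum rh := by
    refine (Real.rpow_le_rpow (Real.sqrt_nonneg _) h1 (by norm_num)).trans (le_of_eq ?_)
    rw [Real.mul_rpow (by positivity) (Real.sqrt_nonneg _), m.sqrt_alpha, ← Real.rpow_mul hA]
    norm_num
  constructor
  · have h3 := m.avgSum_add_le hr (hrh.sub hr)
    have h4 := m.avgSum_le (hrh.sub hr)
    simp only [Pi.sub_apply, add_sub_cancel] at h3 h4
    simp_rw [abs_sub_comm (rh _) (r _)] at h4
    exact h3.trans (add_le_add le_rfl (h4.trans h2))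
  · have h3 := m.avgSum_add_le hrh (hr.sub hrh)
    have h4 := m.avgSum_le (hr.sub hrh)
    simp only [Pi.sub_apply, add_sub_cancel] at h3 h4
    linarith [h3, h4.trans h2]

end EquiFEM

theorem theorem2p1 (a a' b b' c : ℝ → ℝ) (a₀ : ℝ)
    (hcoef : EquiFEM.IsElliptic a a' b b' c a₀) :
    ∃ C > (0 : ℝ), ∃ c₀ > (0 : ℝ),
      ∀ f : ℝ → ℝ, MemLp f 2 EquiFEM.muOmega →
      ∀ u u' : ℝ → ℝ, EquiFEM.IsWeakSol a b c f u u' →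
        (∀ (N : ℕ) (m : EquiFEM.Mesh N) (uh : ℝ → ℝ), EquiFEM.IsEquiFESol m a a' b c f uh →
          EquiFEM.normLp 2 (fun x => u' x - deriv uh x) ≤
            C * Real.sqrt (m.alpha (EquiFEM.residual a' b c f uh (deriv uh))) / N) ∧
        (∀ ε > (0 : ℝ), ∃ N₀ : ℕ, ∀ N ≥ N₀, ∀ (m : EquiFEM.Mesh N) (uh : ℝ → ℝ),
          EquiFEM.IsEquiFESol m a a' b c f uh →
          |Real.sqrt (m.alpha (EquiFEM.residual a' b c f uh (deriv uh))) -
            EquiFEM.normLp (2 / 3) (EquiFEM.residual a' b c f u u')| < ε) ∧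
        (∀ r' : ℝ → ℝ, EquiFEM.HasWeakDeriv (EquiFEM.residual a' b c f u u') r' →
          MemLp r' 1 EquiFEM.muOmega →
          ∀ (N : ℕ) (m : EquiFEM.Mesh N) (uh : ℝ → ℝ), c₀ < N →
          EquiFEM.IsEquiFESol m a a' b c f uh →
          (1 + (c₀ / N) ^ (2 / 3 : ℝ)) ^ (-(3 / 2) : ℝ) *
              EquiFEM.normLp (2 / 3) (EquiFEM.residual a' b c f u u') ≤
            Real.sqrt (m.alpha (EquiFEM.residual a' b c f uh (deriv uh))) ∧
          Real.sqrt (m.alpha (EquiFEM.residual a' b c f uh (deriv uh))) ≤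
            (1 - (c₀ / N) ^ (2 / 3 : ℝ)) ^ (-(3 / 2) : ℝ) *
              (EquiFEM.normLp (2 / 3) (EquiFEM.residual a' b c f u u') ^ (2 / 3 : ℝ) +
                (c₀ * EquiFEM.normLp 1 r' / N) ^ (2 / 3 : ℝ)) ^ (3 / 2 : ℝ)) := by
  obtain ⟨M₁, hM₁, hab⟩ := EquiFEM.exists_ae_bound_of_memLp_top
    (hcoef.memA.memLp_deriv.sub hcoef.memB.memLp)
  obtain ⟨M₂, hM₂, hc⟩ := EquiFEM.exists_ae_bound_of_memLp_top hcoef.memC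
  have hM : 0 ≤ max M₁ M₂ := hM₁.trans (le_max_left _ _)
  have hab' : ∀ᵐ x ∂EquiFEM.muOmega, |a' x - b x| ≤ max M₁ M₂ := by
    filter_upwards [hab] with x hx using hx.trans (le_max_left _ _)
  have hc' : ∀ᵐ x ∂EquiFEM.muOmega, |c x| ≤ max M₁ M₂ := by
    filter_upwards [hc] with x hx using hx.trans (le_max_right _ _)
  have ha₀ := hcoef.pos
  -- The second entry controls the perturbation of the residual, the first the cell lengths `h ≤
  -- 2/N` in the bound with `r'`.
  set K := max 2 (2 * max M₁ M₂ * (6 / a₀)) with hK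
  have hK2 : 2 ≤ K := le_max_left _ _
  refine ⟨6 / a₀, by positivity, K, by linarith, fun f hf u u' hu => ⟨?_, ?_, ?_⟩⟩
  · intro N m uh hs
    rw [EquiFEM.normLp_two]
    exact hs.error_le hcoef hf hu
  · intro ε hε
    have hr := EquiFEM.memLp_residual hcoef.memA.memLp_deriv hcoef.memB.memLp hcoef.memC hf
      hu.mem.memH1.memLp hu.mem.memH1.memLp_deriv
    rw [EquiFEM.normLp_two_thirds]
    set R := ∫ x in EquiFEM.Omega, |EquiFEM.residual a' b c f u u' x| ^ (2 / 3 : ℝ) with hR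
    have hR0 : 0 ≤ R := integral_nonneg fun _ => by positivity
    -- Continuity of `t^(3/2)` at `R` reduces the limit of `√α` to that of `avgSum`.
    obtain ⟨δ, hδ, hcont⟩ := Metric.continuousAt_iff.1
      (Real.continuousAt_rpow_const R (3 / 2) (Or.inr (by norm_num))) ε hε
    have hδ' : 0 < min (δ / 4) 1 := by positivity
    obtain ⟨N₁, hN₁⟩ := EquiFEM.Mesh.exists_avgSum_le_add hr hδ' 2
    -- `q ≤ 1/2` lets the term `q A` be absorbed, so `A ≤ 2 (R + 1)`; the second entry then makes `q
    -- A ≤ δ / 4`.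
    have hq0 : 0 < min (1 / 2) (δ / (8 * (R + 1))) := by positivity
    have hlim : Tendsto (fun n : ℕ => (K / (n : ℝ)) ^ (2 / 3 : ℝ)) atTop (𝓝 0) := by
      have := (tendsto_const_div_atTop_nhds_zero_nat K).rpow_const (p := 2 / 3)
        (Or.inr (by norm_num))
      rwa [Real.zero_rpow (by norm_num)] at this
    obtain ⟨N₂, hN₂⟩ := eventually_atTop.1 (hlim.eventually (gt_mem_nhds hq0))
    refine ⟨max N₁ N₂, fun N hN m uh hs => ?_⟩
    obtain ⟨hb1, hb2⟩ := hs.avgSum_bounds hcoef hM hab' hc' (le_max_right 2 _) hf hu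
    have hb3 := hN₁ N (le_of_max_le_left hN) m (fun i hi => hs.equi.h_le hi)
    have hb4 := m.integral_rpow_le_avgSum hr
    have hq := hN₂ N (le_of_max_le_right hN)
    rw [← hK] at hb1 hb2
    rw [m.sqrt_alpha]
    set A := m.avgSum (EquiFEM.residual a' b c f uh (deriv uh))
    set q := (K / (N : ℝ)) ^ (2 / 3 : ℝ)
    have hA0 : 0 ≤ A := m.avgSum_nonneg _
    have hqn : 0 ≤ q := by positivity
    have hq1 : q ≤ 1 / 2 := hq.le.trans (min_le_left _ _)
    have hq2 : q * (8 * (R + 1)) < δ :=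
      (lt_div_iff₀ (by positivity)).1 (hq.trans_le (min_le_right _ _))
    have hm1 := min_le_left (δ / 4) 1
    have hm2 := min_le_right (δ / 4) 1
    have hA2 : A ≤ 2 * (R + 1) := by nlinarith
    have hqA : q * A ≤ δ / 4 := by nlinarith
    refine hcont ?_
    rw [Real.dist_eq, abs_lt]
    constructor <;> linarith
  · intro r' hr' hr'1 N m uh hN hs
    have hr := EquiFEM.memLp_residual hcoef.memA.memLp_deriv hcoef.memB.memLp hcoef.memC hf
      hu.mem.memH1.memLp hu.mem.memH1.memLp_deriv
    have hN0 : (0 : ℝ) < N := Nat.cast_pos.2 m.pos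
    have hK0 : 0 < K := by linarith
    obtain ⟨hb1, hb2⟩ := hs.avgSum_bounds hcoef hM hab' hc' (le_max_right 2 _) hf hu
    have hb4 := m.integral_rpow_le_avgSum hr
    obtain ⟨G, hG, hrG⟩ := hr'.exists_isPrimitive (memLp_one_iff_integrable.1 hr'1)
    have hb5 := m.avgSum_le_of_isPrimitive hG (fun i hi => hs.equi.h_le hi)
    have eG : ∫ x in EquiFEM.Omega, |G x| ^ (2 / 3 : ℝ) =
        ∫ x in EquiFEM.Omega, |EquiFEM.residual a' b c f u u' x| ^ (2 / 3 : ℝ) := by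
      refine integral_congr_ae ?_
      filter_upwards [hrG] with x hx
      rw [hx]
    rw [← m.avgSum_congr hrG, eG, ← EquiFEM.normLp_one] at hb5
    rw [← hK] at hb1 hb2
    rw [EquiFEM.normLp_two_thirds, m.sqrt_alpha]
    set A := m.avgSum (EquiFEM.residual a' b c f uh (deriv uh))
    set R := ∫ x in EquiFEM.Omega, |EquiFEM.residual a' b c f u u' x| ^ (2 / 3 : ℝ)
    have hA0 : 0 ≤ A := m.avgSum_nonneg _
    have hR0 : 0 ≤ R := integral_nonneg fun _ => by positivity
    have hn1 : 0 ≤ EquiFEM.normLp 1 r' := by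
      rw [EquiFEM.normLp_one]; exact integral_nonneg fun _ => abs_nonneg _
    -- The condition `c₀ < N` is what allows division by `1 - q`.
    have hq1 : (K / (N : ℝ)) ^ (2 / 3 : ℝ) < 1 :=
      Real.rpow_lt_one (by positivity) ((div_lt_one hN0).2 hN) (by norm_num)
    have hqn : 0 ≤ (K / (N : ℝ)) ^ (2 / 3 : ℝ) := by positivity
    have hb6 : (2 / N * EquiFEM.normLp 1 r') ^ (2 / 3 : ℝ) ≤
        (K * EquiFEM.normLp 1 r' / N) ^ (2 / 3 : ℝ) := by
      refine Real.rpow_le_rpow (by positivity) ?_ (by norm_num)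
      rw [div_mul_eq_mul_div]
      gcongr
    set q := (K / (N : ℝ)) ^ (2 / 3 : ℝ)
    have e1 : (R ^ (3 / 2 : ℝ)) ^ (2 / 3 : ℝ) = R := by
      rw [← Real.rpow_mul hR0]; norm_num
    rw [e1]
    have h1q : 0 < 1 - q := by linarith
    have hX : 0 ≤ (K * EquiFEM.normLp 1 r' / N) ^ (2 / 3 : ℝ) := by positivity
    constructor
    · rw [Real.rpow_neg (by positivity), inv_mul_le_iff₀ (by positivity),
        ← Real.mul_rpow (by positivity) hA0]
      exact Real.rpow_le_rpow hR0 (hb4.trans hb2) (by norm_num)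
    · rw [Real.rpow_neg h1q.le, ← div_eq_inv_mul, le_div_iff₀ (by positivity),
        ← Real.mul_rpow hA0 h1q.le]
      refine Real.rpow_le_rpow (by positivity) ?_ (by norm_num)
      linarith
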